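/- Let $K$ be an algebraically closed field of characteristic zero. The Waring rank $\operatorname{rk} f$ of a form (homogeneous polynomial) $f$ of degree $d$ is the least number $r$ such that $f = L_1^d+\dots+L_r^d$ for some linear forms $L_1,\dots,L_r$. Then: (1) every ternary quartic, i.e. every form $f\in K[x_0,x_1,x_2]$ of degree $4$, satisfies $\operatorname{rk} f\le 7$; (2) if $q\in K[x_0,x_1,x_2]$ is a quadratic form such that the conic $q=0$ in $\mathbb{P}^2$ is nondegenerate (nonsingular), and $l$ is a linear form such that the line $l=0$ is tangent to this conic at one of its points, then $\operatorname{rk}(q\,l^2)=7$. Consequently, the maximal Waring rank of plane quartics over $K$ is exactly $7$: it is attained, and no ternary quartic has larger rank. -/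

import Mathlib

/-- `f` is a sum of `r` many `d`-th powers of linear forms (possibly zero). -/
def IsSumOfPowers {K σ : Type*} [CommSemiring K] (d r : ℕ) (f : MvPolynomial σ K) : Prop :=
  ∃ L : Fin r → MvPolynomial σ K, (∀ i, (L i).IsHomogeneous 1) ∧ f = ∑ i, L i ^ d

/-- The Waring rank of a form `f` of degree `d`: the least number of summands in an expression
of `f` as a sum of `d`-th powers of linear forms (`⊤` if there is no such expression). -/
noncomputable def waringRank {K σ : Type*} [CommSemiring K] (d : ℕ) (f : MvPolynomial σ K) : ℕ∞ :=
  sInf {r : ℕ∞ | ∃ n : ℕ, r = n ∧ IsSumOfPowers d n f}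

/-- `q = 0` is a nondegenerate (that is, nonsingular) conic in the projective plane: `q` is a
quadratic form whose partial derivatives have no common zero in the plane. -/
def IsNondegenerateConic {K : Type*} [CommRing K] (q : MvPolynomial (Fin 3) K) : Prop :=
  q.IsHomogeneous 2 ∧
    ∀ p : Fin 3 → K, (∀ i, MvPolynomial.eval p (MvPolynomial.pderiv i q) = 0) → p = 0

/-- `l` is an equation of the tangent line to the nonsingular conic `q = 0` at one of its points
`p`, i.e. a nonzero multiple of `∑ i, (∂q/∂Xᵢ)(p) Xᵢ`. -/
def IsTangentLine {K : Type*} [CommRing K] (q l : MvPolynomial (Fin 3) K) : Prop :=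
  ∃ p : Fin 3 → K, p ≠ 0 ∧ MvPolynomial.eval p q = 0 ∧
    ∃ c : K, c ≠ 0 ∧
      l = MvPolynomial.C c *
        ∑ i, MvPolynomial.C (MvPolynomial.eval p (MvPolynomial.pderiv i q)) * MvPolynomial.X i

/-!
A quartic form `f` is encoded by the linear functional `dual f` on quartic forms for which the
fourth power of the linear form with coefficient vector `p` becomes evaluation at `p`. Writing `f`
as a sum of `r` fourth powers then means writing this functional `φ` as a combination of `r` point
evaluations, and the argument is governed by the conics apolar to `φ`, that is the quadratic forms
`Q` such that `φ` kills all quartic multiples of `Q`.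

The upper bound (`hasDecomp_seven`) distinguishes cases.

* Some apolar conic is a pair of distinct lines (`hasDecomp_seven_of_line_pair`). Then `f` is the
  sum of a binary quartic in `x, y` and one in `x, z`, and a multiple of `x⁴` can be moved from one
  to the other. After a general such move each of them needs three summands, except that a quartic
  `x³l` with `l` not a multiple of `x` needs four; if both are exceptional then `f` is binary.
* The only apolar conic is nonsingular (`IsSmooth.hasDecomp_five`). Restricting to this conic turns
  `φ` into a binary octic with nondegenerate catalecticant, and a general quintic apolar to it has
  five distinct roots.
* There is a nonsingular apolar conic and a further one, but no pair of distinct lines is apolar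
  (`hasDecomp_six_of_pencil`). Then the apolar conics form a pencil, and adding one evaluation leads
  to the preceding case.
* No conic is apolar (`hasDecomp_seven_of_no_apolar_conic`). Every evaluation at a point `p` on
  conics is represented by a conic `Q_p`, and by a trace argument `Q_p p ≠ 0` for some `p`. Removing
  this evaluation makes `Q_p` the only apolar conic, and six more evaluations suffice unless `Q_p`
  is a double line.
* What is left is the case in which the square of a line is apolar, and no other conic is, or
  represents evaluation at a point off the line (`hasDecomp_seven_of_line_and_point`). Here the
  evaluation to be removed is that at a general point of the line `X₂ = 0`: in coordinates in which
  the Hessian of the binary cubic form given by `R ↦ φ (X₂ R)` vanishes at `(0, 1)`, the conic that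
  represents this evaluation is explicit (`exists_tangent_conic`).

For the lower bound (`not_isSumOfPowers_conic_mul_tangent_sq`), the functional of `q l²` is, in
suitable coordinates, the second Taylor coefficient along a curve germ at `(1, 0, 0)` tangent to the
line `X₂ = 0`. Given six points, three lines that avoid `(1, 0, 0)` and together with the tangent
line pass through all of them give a quartic on which the six evaluations vanish while the Taylor
coefficient does not; such lines exist unless four of the points lie on a line through `(1, 0, 0)`,
and then that line and three further ones do (`not_sum_six_evals`).
-/

namespace PlaneQuartic

open MvPolynomial

variable {K : Type*} [Field K]

/-! ### Forms, functionals and coordinate changes -/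

/-- The linear form with coefficient vector `v`. -/
noncomputable def lin (v : Fin 3 → K) : MvPolynomial (Fin 3) K := ∑ i, C (v i) * X i

/-- The endomorphism of the polynomial ring that replaces `X i` by the linear form given by the
`i`-th row of `M`. -/
noncomputable def subst (M : Matrix (Fin 3) (Fin 3) K) :
    MvPolynomial (Fin 3) K →ₐ[K] MvPolynomial (Fin 3) K :=
  aeval fun i => lin (M i)

/-- The quadratic form with the given coefficients at
`X₀², X₀X₁, X₀X₂, X₁², X₁X₂, X₂²`. -/
noncomputable def conic (c : Fin 6 → K) : MvPolynomial (Fin 3) K :=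
  C (c 0) * (X 0 * X 0) + C (c 1) * (X 0 * X 1) + C (c 2) * (X 0 * X 2) + C (c 3) * (X 1 * X 1)
    + C (c 4) * (X 1 * X 2) + C (c 5) * (X 2 * X 2)

/-- `Q` is a quadratic form such that `φ` vanishes on all quartic forms divisible by `Q`. -/
def Apolar (φ : MvPolynomial (Fin 3) K →ₗ[K] K) (Q : MvPolynomial (Fin 3) K) : Prop :=
  Q.IsHomogeneous 2 ∧ ∀ R : MvPolynomial (Fin 3) K, R.IsHomogeneous 2 → φ (Q * R) = 0

/-- On quartic forms, `φ` is a linear combination of at most `r` evaluations at points. -/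
def HasDecomp (φ : MvPolynomial (Fin 3) K →ₗ[K] K) (r : ℕ) : Prop :=
  ∃ s : List (K × (Fin 3 → K)), s.length ≤ r ∧
    ∀ F : MvPolynomial (Fin 3) K, F.IsHomogeneous 4 →
      φ F = (s.map fun q => q.1 * eval q.2 F).sum

lemma lin_eq (v : Fin 3 → K) : lin v = C (v 0) * X 0 + C (v 1) * X 1 + C (v 2) * X 2 := by
  simp [lin, Fin.sum_univ_three]

lemma lin_isHomogeneous (v : Fin 3 → K) : (lin v).IsHomogeneous 1 :=
  IsHomogeneous.sum _ _ _ fun _ _ => isHomogeneous_C_mul_X _ _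

lemma eval_lin (v p : Fin 3 → K) : eval p (lin v) = v 0 * p 0 + v 1 * p 1 + v 2 * p 2 := by
  simp [lin_eq]

lemma isHomogeneous_X_mul_X (i j : Fin 3) :
    (X i * X j : MvPolynomial (Fin 3) K).IsHomogeneous 2 :=
  (isHomogeneous_X K i).mul (isHomogeneous_X K j)

lemma lin_mul_lin_isHomogeneous (u v : Fin 3 → K) : (lin u * lin v).IsHomogeneous 2 :=
  (lin_isHomogeneous u).mul (lin_isHomogeneous v)

lemma conic_isHomogeneous (c : Fin 6 → K) : (conic c).IsHomogeneous 2 := by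
  unfold conic
  exact (((((isHomogeneous_X_mul_X _ _).C_mul _).add ((isHomogeneous_X_mul_X _ _).C_mul _)).add
    ((isHomogeneous_X_mul_X _ _).C_mul _)).add ((isHomogeneous_X_mul_X _ _).C_mul _)).add
    ((isHomogeneous_X_mul_X _ _).C_mul _) |>.add ((isHomogeneous_X_mul_X _ _).C_mul _)

lemma eval_conic (c : Fin 6 → K) (p : Fin 3 → K) :
    eval p (conic c) = c 0 * (p 0 * p 0) + c 1 * (p 0 * p 1) + c 2 * (p 0 * p 2)
      + c 3 * (p 1 * p 1) + c 4 * (p 1 * p 2) + c 5 * (p 2 * p 2) := by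
  simp [conic]

lemma conic_eq_zero {c : Fin 6 → K} (h : conic c = 0) : c = 0 := by
  have key (p : Fin 3 → K) := (eval_conic c p).symm.trans (by rw [h, map_zero])
  have h0 := key ![1, 0, 0]
  have h3 := key ![0, 1, 0]
  have h5 := key ![0, 0, 1]
  have h1 := key ![1, 1, 0]
  have h2 := key ![1, 0, 1]
  have h4 := key ![0, 1, 1]
  simp at h0 h3 h5 h1 h2 h4
  simp [h0, h3, h5] at h1 h2 h4
  ext i
  fin_cases i <;> simp [h0, h1, h2, h3, h4, h5]

lemma conic_sub (c d : Fin 6 → K) : conic (c - d) = conic c - conic d := by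
  simp [conic]; ring

lemma conic_add (c d : Fin 6 → K) : conic (c + d) = conic c + conic d := by
  simp [conic]; ring

lemma conic_smul (k : K) (c : Fin 6 → K) : conic (k • c) = C k * conic c := by
  simp [conic]; ring

lemma conic_injective : Function.Injective (conic : (Fin 6 → K) → _) := fun c d h =>
  sub_eq_zero.1 (conic_eq_zero (by rw [conic_sub, h, sub_self]))

/-- Every form of degree `n` is a linear combination of the monomials of degree `n`; stated as an
induction principle. -/
lemma form_induction {n : ℕ} {p : MvPolynomial (Fin 3) K → Prop}
    (hmon : ∀ (k : K) (a b c : ℕ), a + b + c = n → p (C k * (X 0 ^ a * X 1 ^ b * X 2 ^ c)))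
    (hzero : p 0) (hadd : ∀ F G, p F → p G → p (F + G))
    {F : MvPolynomial (Fin 3) K} (hF : F.IsHomogeneous n) : p F := by
  rw [F.as_sum]
  refine Finset.sum_induction _ p hadd hzero fun m hm => ?_
  have hd := hF (mem_support_iff.1 hm)
  rw [monomial_eq, Finsupp.prod_fintype _ _ (by simp), Fin.prod_univ_three]
  refine hmon _ _ _ _ ?_
  rw [← hd]
  simp [Finsupp.weight_apply, Finsupp.sum_fintype, Fin.sum_univ_three]

lemma exists_conic {Q : MvPolynomial (Fin 3) K} (hQ : Q.IsHomogeneous 2) : ∃ c, Q = conic c := by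
  refine form_induction (p := fun Q => ∃ c, Q = conic c) ?_ ⟨0, by simp [conic]⟩ ?_ hQ
  · intro k a b c h
    have ha : a ≤ 2 := by omega
    have hb : b ≤ 2 := by omega
    obtain rfl : c = 2 - a - b := by omega
    interval_cases a <;> interval_cases b <;> first | omega | skip
    · exact ⟨![0, 0, 0, 0, 0, k], by simp [conic, pow_two]⟩
    · exact ⟨![0, 0, 0, 0, k, 0], by simp [conic]⟩
    · exact ⟨![0, 0, 0, k, 0, 0], by simp [conic, pow_two]⟩
    · exact ⟨![0, 0, k, 0, 0, 0], by simp [conic]⟩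
    · exact ⟨![0, k, 0, 0, 0, 0], by simp [conic]⟩
    · exact ⟨![k, 0, 0, 0, 0, 0], by simp [conic, pow_two]⟩
  · rintro _ _ ⟨c, rfl⟩ ⟨d, rfl⟩
    exact ⟨c + d, (conic_add c d).symm⟩

lemma exists_lin {F : MvPolynomial (Fin 3) K} (hF : F.IsHomogeneous 1) : ∃ v, F = lin v := by
  refine form_induction (p := fun Q => ∃ c, Q = lin c) ?_ ⟨0, by simp [lin]⟩ ?_ hF
  · intro k a b c h
    have ha : a ≤ 1 := by omega
    have hb : b ≤ 1 := by omega
    obtain rfl : c = 1 - a - b := by omega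
    interval_cases a <;> interval_cases b <;> first | omega | skip
    · exact ⟨![0, 0, k], by simp [lin_eq]⟩
    · exact ⟨![0, k, 0], by simp [lin_eq]⟩
    · exact ⟨![k, 0, 0], by simp [lin_eq]⟩
  · rintro _ _ ⟨c, rfl⟩ ⟨d, rfl⟩
    exact ⟨c + d, by simp [lin_eq]; ring⟩

/-- Two functionals agree on quartic forms once they agree on the fifteen quartic monomials. -/
lemma eq_on_quartics {φ χ : MvPolynomial (Fin 3) K →ₗ[K] K}
    (h : ∀ a b c : ℕ, a + b + c = 4 → φ (X 0 ^ a * X 1 ^ b * X 2 ^ c)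
      = χ (X 0 ^ a * X 1 ^ b * X 2 ^ c))
    {F : MvPolynomial (Fin 3) K} (hF : F.IsHomogeneous 4) : φ F = χ F := by
  refine form_induction (p := fun F => φ F = χ F) ?_ (by simp) ?_ hF
  · intro k a b c habc
    rw [C_mul', map_smul, map_smul, h a b c habc]
  · intro F G hF hG
    rw [map_add, map_add, hF, hG]

/-- Two functionals agree on conics once they agree on the six quadratic monomials. -/
lemma eq_on_conics {φ χ : MvPolynomial (Fin 3) K →ₗ[K] K}
    (h00 : φ (X 0 * X 0) = χ (X 0 * X 0)) (h01 : φ (X 0 * X 1) = χ (X 0 * X 1))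
    (h02 : φ (X 0 * X 2) = χ (X 0 * X 2)) (h11 : φ (X 1 * X 1) = χ (X 1 * X 1))
    (h12 : φ (X 1 * X 2) = χ (X 1 * X 2)) (h22 : φ (X 2 * X 2) = χ (X 2 * X 2))
    {Q : MvPolynomial (Fin 3) K} (hQ : Q.IsHomogeneous 2) : φ Q = χ Q := by
  obtain ⟨c, rfl⟩ := exists_conic hQ
  simp only [conic, map_add, C_mul', map_smul, h00, h01, h02, h11, h12, h22]

/-- Evaluation at `p` as a linear functional. -/
noncomputable def evalAt (p : Fin 3 → K) : MvPolynomial (Fin 3) K →ₗ[K] K := (aeval p).toLinearMap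

@[simp] lemma evalAt_apply (p : Fin 3 → K) (F : MvPolynomial (Fin 3) K) :
    evalAt p F = eval p F := by
  simp [evalAt, aeval_eq_eval]

/-- `F ↦ φ (Q * F)`. -/
noncomputable def mulBy (φ : MvPolynomial (Fin 3) K →ₗ[K] K) (Q : MvPolynomial (Fin 3) K) :
    MvPolynomial (Fin 3) K →ₗ[K] K := φ ∘ₗ LinearMap.mulLeft K Q

/-- Apolarity may be tested on the six quadratic monomials. -/
lemma apolar_of_monomials {φ : MvPolynomial (Fin 3) K →ₗ[K] K} {Q : MvPolynomial (Fin 3) K}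
    (hQ : Q.IsHomogeneous 2) (h00 : φ (Q * (X 0 * X 0)) = 0) (h01 : φ (Q * (X 0 * X 1)) = 0)
    (h02 : φ (Q * (X 0 * X 2)) = 0) (h11 : φ (Q * (X 1 * X 1)) = 0)
    (h12 : φ (Q * (X 1 * X 2)) = 0) (h22 : φ (Q * (X 2 * X 2)) = 0) : Apolar φ Q :=
  ⟨hQ, fun _ hR => eq_on_conics (φ := mulBy φ Q) (χ := 0) h00 h01 h02 h11 h12 h22 hR⟩

lemma Apolar.add {φ : MvPolynomial (Fin 3) K →ₗ[K] K} {P Q : MvPolynomial (Fin 3) K}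
    (hP : Apolar φ P) (hQ : Apolar φ Q) : Apolar φ (P + Q) :=
  ⟨hP.1.add hQ.1, fun R hR => by rw [add_mul, map_add, hP.2 R hR, hQ.2 R hR, add_zero]⟩

lemma Apolar.C_mul {φ : MvPolynomial (Fin 3) K →ₗ[K] K} {Q : MvPolynomial (Fin 3) K}
    (hQ : Apolar φ Q) (k : K) : Apolar φ (C k * Q) :=
  ⟨hQ.1.C_mul k, fun R hR => by rw [mul_assoc, C_mul', map_smul, hQ.2 R hR, smul_zero]⟩

lemma Apolar.sub {φ : MvPolynomial (Fin 3) K →ₗ[K] K} {P Q : MvPolynomial (Fin 3) K}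
    (hP : Apolar φ P) (hQ : Apolar φ Q) : Apolar φ (P - Q) :=
  ⟨hP.1.sub hQ.1, fun R hR => by rw [sub_mul, map_sub, hP.2 R hR, hQ.2 R hR, sub_zero]⟩

/-! ### Decompositions -/

lemma HasDecomp.mono {φ : MvPolynomial (Fin 3) K →ₗ[K] K} {r s : ℕ} (h : HasDecomp φ r)
    (hrs : r ≤ s) : HasDecomp φ s := by
  obtain ⟨l, hl, h⟩ := h
  exact ⟨l, hl.trans hrs, h⟩

/-- Removing one evaluation costs at most one summand. -/
lemma HasDecomp.of_sub_evalAt {φ : MvPolynomial (Fin 3) K →ₗ[K] K} {r : ℕ} (k : K)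
    (p : Fin 3 → K) (h : HasDecomp (φ - k • evalAt p) r) : HasDecomp φ (r + 1) := by
  obtain ⟨l, hl, h⟩ := h
  refine ⟨(k, p) :: l, by simpa using hl, fun F hF => ?_⟩
  have := h F hF
  simp only [LinearMap.sub_apply, LinearMap.smul_apply, evalAt_apply, smul_eq_mul] at this
  simp only [List.map_cons, List.sum_cons, ← this]
  ring

/-! ### Coordinate changes -/

lemma subst_X (M : Matrix (Fin 3) (Fin 3) K) (i : Fin 3) : subst M (X i) = lin (M i) := by
  simp [subst]

lemma subst_isHomogeneous (M : Matrix (Fin 3) (Fin 3) K) {F : MvPolynomial (Fin 3) K} {n : ℕ}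
    (hF : F.IsHomogeneous n) : (subst M F).IsHomogeneous n := by
  have := hF.aeval (R := K) (S := K) (fun i => lin (M i)) (n := 1) fun _ => lin_isHomogeneous _
  simpa [subst] using this

lemma subst_lin (M : Matrix (Fin 3) (Fin 3) K) (v : Fin 3 → K) :
    subst M (lin v) = lin (Matrix.vecMul v M) := by
  simp only [lin_eq, map_add, map_mul, subst_X, algHom_C, Matrix.vecMul, dotProduct,
    Fin.sum_univ_three, algebraMap_eq]
  ring

lemma eval_subst (M : Matrix (Fin 3) (Fin 3) K) (p : Fin 3 → K) (F : MvPolynomial (Fin 3) K) :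
    eval p (subst M F) = eval (M.mulVec p) F := by
  have h : (aeval p).comp (subst M) = aeval (M.mulVec p) := by
    ext i
    simp [subst_X, aeval_eq_eval, eval_lin, Matrix.mulVec, dotProduct, Fin.sum_univ_three]
  simpa [aeval_eq_eval] using congrArg (fun g => g F) h

lemma subst_subst (M N : Matrix (Fin 3) (Fin 3) K) (F : MvPolynomial (Fin 3) K) :
    subst M (subst N F) = subst (N * M) F := by
  have h : (subst M).comp (subst N) = subst (N * M) := by
    ext1 i
    rw [AlgHom.comp_apply, subst_X, subst_X, subst_lin]
    rfl
  exact congrArg (fun g => g F) h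

lemma subst_one (F : MvPolynomial (Fin 3) K) : subst (1 : Matrix (Fin 3) (Fin 3) K) F = F := by
  have h : subst (1 : Matrix (Fin 3) (Fin 3) K) = AlgHom.id K _ := by
    ext1 i
    fin_cases i <;> simp [subst_X, lin_eq]
  rw [h, AlgHom.id_apply]

lemma subst_subst_inv {M : Matrix (Fin 3) (Fin 3) K} (hM : M.det ≠ 0)
    (F : MvPolynomial (Fin 3) K) : subst M (subst M⁻¹ F) = F := by
  rw [subst_subst, Matrix.nonsing_inv_mul _ (isUnit_iff_ne_zero.2 hM), subst_one]

lemma subst_inv_subst {M : Matrix (Fin 3) (Fin 3) K} (hM : M.det ≠ 0)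
    (F : MvPolynomial (Fin 3) K) : subst M⁻¹ (subst M F) = F := by
  rw [subst_subst, Matrix.mul_nonsing_inv _ (isUnit_iff_ne_zero.2 hM), subst_one]

/-- The functional `φ` read in the coordinates given by the rows of `M`. -/
noncomputable def pull (φ : MvPolynomial (Fin 3) K →ₗ[K] K) (M : Matrix (Fin 3) (Fin 3) K) :
    MvPolynomial (Fin 3) K →ₗ[K] K := φ ∘ₗ (subst M).toLinearMap

@[simp] lemma pull_apply (φ : MvPolynomial (Fin 3) K →ₗ[K] K) (M : Matrix (Fin 3) (Fin 3) K)
    (F : MvPolynomial (Fin 3) K) : pull φ M F = φ (subst M F) := rfl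

lemma HasDecomp.of_pull {φ : MvPolynomial (Fin 3) K →ₗ[K] K} {M : Matrix (Fin 3) (Fin 3) K}
    (hM : M.det ≠ 0) {r : ℕ} (h : HasDecomp (pull φ M) r) : HasDecomp φ r := by
  obtain ⟨l, hl, h⟩ := h
  refine ⟨l.map fun q => (q.1, M⁻¹.mulVec q.2), by simpa using hl, fun F hF => ?_⟩
  have := h (subst M⁻¹ F) (subst_isHomogeneous _ hF)
  rw [pull_apply, subst_subst_inv hM] at this
  rw [this, List.map_map]
  simp [Function.comp_def, eval_subst]

lemma apolar_pull {φ : MvPolynomial (Fin 3) K →ₗ[K] K} {M : Matrix (Fin 3) (Fin 3) K}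
    (hM : M.det ≠ 0) {Q : MvPolynomial (Fin 3) K} : Apolar (pull φ M) Q ↔ Apolar φ (subst M Q) := by
  constructor
  · rintro ⟨hQ, h⟩
    refine ⟨subst_isHomogeneous _ hQ, fun R hR => ?_⟩
    have := h (subst M⁻¹ R) (subst_isHomogeneous _ hR)
    rwa [pull_apply, map_mul, subst_subst_inv hM] at this
  · rintro ⟨hQ, h⟩
    refine ⟨?_, fun R hR => ?_⟩
    · have := subst_isHomogeneous M⁻¹ hQ
      rwa [subst_inv_subst hM] at this
    · rw [pull_apply, map_mul]
      exact h _ (subst_isHomogeneous _ hR)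

end PlaneQuartic

namespace PlaneQuartic

open MvPolynomial

variable {K : Type*} [Field K]

/-! ### Conics up to linear equivalence -/

/-- `Q` is a nonsingular conic: in suitable coordinates it is `X₀X₂ - X₁²`. -/
def IsSmooth (Q : MvPolynomial (Fin 3) K) : Prop :=
  ∃ M : Matrix (Fin 3) (Fin 3) K, M.det ≠ 0 ∧ Q = subst M (X 0 * X 2 - X 1 * X 1)

lemma lin_add (u v : Fin 3 → K) : lin (u + v) = lin u + lin v := by
  simp [lin_eq]; ring

lemma lin_smul (k : K) (u : Fin 3 → K) : lin (k • u) = C k * lin u := by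
  simp [lin_eq]; ring

lemma lin_sub (u v : Fin 3 → K) : lin (u - v) = lin u - lin v := by
  simp [lin_eq]; ring

@[simp] lemma lin_zero : lin (0 : Fin 3 → K) = 0 := by
  simp [lin_eq]

section AlgClosed

variable [IsAlgClosed K] [CharZero K]

/-- Binary quadratic forms split into linear factors. -/
lemma exists_binary_factors (α β γ : K) :
    ∃ r s t u : K, α = r * t ∧ β = r * u + s * t ∧ γ = s * u := by
  rcases eq_or_ne α 0 with rfl | hα
  · exact ⟨0, 1, β, γ, by ring, by ring, by ring⟩
  · obtain ⟨d, hd⟩ := IsAlgClosed.exists_eq_mul_self (discrim α β γ)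
    obtain ⟨x, hx⟩ := exists_quadratic_eq_zero hα ⟨d, hd⟩
    exact ⟨1, -x, α, β + α * x, by ring, by ring, by linear_combination hx⟩

omit [CharZero K] in
/-- A binary quadratic form with vanishing discriminant is the negative of a square. -/
lemma exists_neg_sq {p r w : K} (h : r ^ 2 = 4 * p * w) :
    ∃ u v : K, p = -(u * u) ∧ w = -(v * v) ∧ r = -(u * v + u * v) := by
  obtain ⟨u, hu⟩ := IsAlgClosed.exists_eq_mul_self (-p)
  obtain ⟨v, hv⟩ := IsAlgClosed.exists_eq_mul_self (-w)
  have : (r - 2 * u * v) * (r + 2 * u * v) = 0 := by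
    linear_combination h - 4 * w * hu + 4 * u * u * hv
  rcases mul_eq_zero.1 this with h | h
  · exact ⟨u, -v, by linear_combination -hu, by linear_combination -hv, by linear_combination h⟩
  · exact ⟨u, v, by linear_combination -hu, by linear_combination -hv, by linear_combination h⟩

/-- Every conic has the shape `l₀l₂ - l₁²`: it suffices to find a line `l₀ = 0` on which it
restricts to a square, and in the pencil spanned by `X₀` and `X₁` this is a quadratic condition. -/
lemma exists_mul_sub_sq {Q : MvPolynomial (Fin 3) K} (hQ : Q.IsHomogeneous 2) :
    ∃ M : Matrix (Fin 3) (Fin 3) K, Q = lin (M 0) * lin (M 2) - lin (M 1) * lin (M 1) := by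
  obtain ⟨c, rfl⟩ := exists_conic hQ
  by_cases h : c 2 ^ 2 = 4 * c 0 * c 5
  · obtain ⟨u, v, h0, h5, h2⟩ := exists_neg_sq h
    refine ⟨![![0, 1, 0], ![u, 0, v], ![c 1, c 3, c 4]], ?_⟩
    simp only [conic, lin_eq, h0, h5, h2]
    simp
    ring
  · have ha : c 2 ^ 2 - 4 * c 0 * c 5 ≠ 0 := sub_ne_zero.2 h
    obtain ⟨d, hd⟩ := IsAlgClosed.exists_eq_mul_self (discrim (c 2 ^ 2 - 4 * c 0 * c 5)
      (2 * c 2 * c 4 - 4 * c 1 * c 5) (c 4 ^ 2 - 4 * c 3 * c 5))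
    obtain ⟨s, hs⟩ := exists_quadratic_eq_zero ha ⟨d, hd⟩
    obtain ⟨u, v, hb, hc, hbc⟩ := exists_neg_sq (p := c 0 * s ^ 2 + c 1 * s + c 3)
      (r := c 2 * s + c 4) (w := c 5) (by linear_combination hs)
    have h3 : c 3 = -(u * u) - c 0 * s ^ 2 - c 1 * s := by linear_combination hb
    have h4 : c 4 = -(u * v + u * v) - c 2 * s := by linear_combination hbc
    refine ⟨![![1, -s, 0], ![0, u, v], ![c 0, c 0 * s + c 1, c 2]], ?_⟩
    simp only [conic, lin_eq, h3, h4, hc]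
    simp
    ring

/-- A quadratic form in two linear forms is a pair of lines. -/
lemma exists_lin_mul_lin (α β γ : K) (u v : Fin 3 → K) :
    ∃ u' v' : Fin 3 → K, C α * (lin u * lin u) + C β * (lin u * lin v) + C γ * (lin v * lin v)
      = lin u' * lin v' := by
  obtain ⟨r, s, t, w, rfl, rfl, rfl⟩ := exists_binary_factors α β γ
  refine ⟨r • u + s • v, t • u + w • v, ?_⟩
  simp only [lin_add, lin_smul, C_mul, C_add]
  ring

/-- A conic is a pair of lines or nonsingular. -/
lemma lin_mul_lin_or_isSmooth {Q : MvPolynomial (Fin 3) K} (hQ : Q.IsHomogeneous 2) :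
    (∃ u v, Q = lin u * lin v) ∨ IsSmooth Q := by
  obtain ⟨M, rfl⟩ := exists_mul_sub_sq hQ
  by_cases hM : M.det = 0
  · left
    obtain ⟨v, hv, hvM⟩ := Matrix.exists_vecMul_eq_zero_iff.2 hM
    have hrel := subst_lin M v
    rw [hvM, lin_zero, lin_eq] at hrel
    simp only [map_add, map_mul, subst_X, algHom_C, algebraMap_eq] at hrel
    have hC {k : K} (hk : k ≠ 0) : (C k⁻¹ * C k : MvPolynomial (Fin 3) K) = 1 := by
      rw [← C_mul, inv_mul_cancel₀ hk, C_1]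
    by_cases h1 : v 1 = 0
    · by_cases h0 : v 0 = 0
      · have h2 : v 2 ≠ 0 := by
          rintro h2
          exact hv (by ext i; fin_cases i <;> simp [h0, h1, h2])
        have : lin (M 2) = 0 := by
          rw [h0, h1] at hrel
          simp only [C_0] at hrel
          linear_combination C (v 2)⁻¹ * hrel - lin (M 2) * hC h2
        obtain ⟨u', v', h⟩ := exists_lin_mul_lin (-1) 0 0 (M 1) (M 1)
        refine ⟨u', v', ?_⟩
        rw [← h, this]
        simp
      · have : lin (M 0) = C (-((v 0)⁻¹ * v 2)) * lin (M 2) := by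
          rw [h1] at hrel
          simp only [C_0, C_neg, C_mul] at hrel ⊢
          linear_combination C (v 0)⁻¹ * hrel - lin (M 0) * hC h0
        obtain ⟨u', v', h⟩ := exists_lin_mul_lin (-((v 0)⁻¹ * v 2)) 0 (-1) (M 2) (M 1)
        refine ⟨u', v', ?_⟩
        rw [← h, this]
        simp
        ring
    · have : lin (M 1) = C (-((v 1)⁻¹ * v 0)) * lin (M 0) + C (-((v 1)⁻¹ * v 2)) * lin (M 2) := by
        simp only [C_neg, C_mul] at hrel ⊢
        linear_combination C (v 1)⁻¹ * hrel - lin (M 1) * hC h1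
      obtain ⟨u', v', h⟩ := exists_lin_mul_lin (-(((v 1)⁻¹ * v 0) ^ 2))
        (1 - 2 * ((v 1)⁻¹ * v 0) * ((v 1)⁻¹ * v 2)) (-(((v 1)⁻¹ * v 2) ^ 2)) (M 0) (M 2)
      refine ⟨u', v', ?_⟩
      rw [← h, this]
      simp only [C_neg, C_mul, C_sub, C_pow, C_1, map_ofNat]
      ring
  · right
    refine ⟨M, hM, ?_⟩
    simp [subst_X]

end AlgClosed

lemma subst_X_mul_X (M : Matrix (Fin 3) (Fin 3) K) (i j : Fin 3) :
    subst M (X i * X j) = lin (M i) * lin (M j) := by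
  rw [map_mul, subst_X, subst_X]

/-- Two linear forms are proportional or part of a coordinate system. -/
lemma proportional_or_exists_matrix (u v : Fin 3 → K) :
    v = 0 ∨ (∃ k : K, u = k • v) ∨
      ∃ M : Matrix (Fin 3) (Fin 3) K, M.det ≠ 0 ∧ M 1 = u ∧ M 2 = v := by
  by_cases h : crossProduct u v = 0
  · rw [← not_ne_iff, crossProduct_ne_zero_iff_linearIndependent,
      LinearIndependent.pair_iff] at h
    push Not at h
    obtain ⟨s, t, hst, hne⟩ := h
    by_cases hs : s = 0
    · have ht : t ≠ 0 := hne hs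
      exact Or.inl (by simpa [hs, ht] using hst)
    · refine Or.inr (Or.inl ⟨-(s⁻¹ * t), ?_⟩)
      rw [neg_smul, mul_smul, eq_neg_iff_add_eq_zero]
      have := congrArg (s⁻¹ • ·) hst
      simpa [smul_smul, hs] using this
  · obtain ⟨i, hi⟩ := Function.ne_iff.1 h
    refine Or.inr (Or.inr ⟨![Pi.single i 1, u, v], ?_, rfl, rfl⟩)
    have := triple_product_eq_det (Pi.single i 1) u v
    rw [single_one_dotProduct] at this
    change Matrix.det ![Pi.single i 1, u, v] ≠ 0
    rw [← this]
    exact hi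

/-- A pair of lines is a multiple of a double line, or consists of two lines `X₁ = 0`, `X₂ = 0` of
a coordinate system. -/
lemma lin_mul_lin_eq_sq_or_exists_matrix (u v : Fin 3 → K) :
    (∃ (k : K) (w : Fin 3 → K), lin u * lin v = C k * (lin w * lin w)) ∨
      ∃ M : Matrix (Fin 3) (Fin 3) K, M.det ≠ 0 ∧ lin u * lin v = subst M (X 1 * X 2) := by
  rcases proportional_or_exists_matrix u v with rfl | ⟨k, rfl⟩ | ⟨M, hM, rfl, rfl⟩
  · exact Or.inl ⟨0, 0, by simp⟩
  · exact Or.inl ⟨k, v, by rw [lin_smul, mul_assoc]⟩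
  · exact Or.inr ⟨M, hM, (subst_X_mul_X M 1 2).symm⟩

/-- The pencil spanned by two different double lines contains a pair of distinct lines, by the
factorization of `t² - s²`. -/
lemma squares_proportional_or_exists_matrix [CharZero K] (t s : Fin 3 → K) :
    lin s * lin s = 0 ∨ (∃ k : K, lin t * lin t = C k * (lin s * lin s)) ∨
      ∃ M : Matrix (Fin 3) (Fin 3) K, M.det ≠ 0 ∧
        lin t * lin t - lin s * lin s = subst M (X 1 * X 2) := by
  rcases proportional_or_exists_matrix (t - s) (t + s) with h | ⟨k, hk⟩ | ⟨M, hM, h1, h2⟩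
  · refine Or.inr (Or.inl ⟨1, ?_⟩)
    rw [add_eq_zero_iff_eq_neg.1 h, ← neg_one_smul K s, lin_smul]
    simp
  · by_cases h1 : k = 1
    · have : s = 0 := by
        rw [h1, one_smul] at hk
        ext i
        have := congrFun hk i
        simp only [Pi.sub_apply, Pi.add_apply] at this
        have : (2 : K) * s i = 0 := by linear_combination -this
        simpa using this
      left
      simp [this]
    · have : t = ((1 + k) / (1 - k)) • s := by
        ext i
        have := congrFun hk i
        simp only [Pi.sub_apply, Pi.add_apply, Pi.smul_apply, smul_eq_mul] at this ⊢
        have hk' : 1 - k ≠ 0 := sub_ne_zero.2 (Ne.symm h1)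
        field_simp
        linear_combination this
      refine Or.inr (Or.inl ⟨((1 + k) / (1 - k)) ^ 2, ?_⟩)
      rw [this, lin_smul, C_pow]
      ring
  · refine Or.inr (Or.inr ⟨M, hM, ?_⟩)
    rw [subst_X_mul_X, h1, h2, lin_add, lin_sub]
    ring

lemma lin_mul_lin_eq_conic (u v : Fin 3 → K) :
    lin u * lin v = conic ![u 0 * v 0, u 0 * v 1 + u 1 * v 0, u 0 * v 2 + u 2 * v 0, u 1 * v 1,
      u 1 * v 2 + u 2 * v 1, u 2 * v 2] := by
  simp [conic, lin_eq]
  ring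

/-- A conic with nonzero discriminant is nonsingular. -/
lemma isSmooth_of_det_ne_zero [IsAlgClosed K] [CharZero K] {c : Fin 6 → K}
    (hc : 4 * c 0 * c 3 * c 5 + c 1 * c 2 * c 4 - c 0 * c 4 ^ 2 - c 3 * c 2 ^ 2 - c 5 * c 1 ^ 2
      ≠ 0) : IsSmooth (conic c) := by
  refine (lin_mul_lin_or_isSmooth (conic_isHomogeneous c)).resolve_left ?_
  rintro ⟨u, v, h⟩
  rw [lin_mul_lin_eq_conic] at h
  rw [conic_injective h] at hc
  apply hc
  simp
  ring

/-- A quadratic form vanishing on the conic `X₀X₂ = X₁²` is a multiple of `X₀X₂ - X₁²`. -/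
lemma conic_eq_of_vanishing [Infinite K] {Q : MvPolynomial (Fin 3) K} (hQ : Q.IsHomogeneous 2)
    (h : ∀ ρ : K, eval ![1, ρ, ρ ^ 2] Q = 0) : ∃ k, Q = C k * (X 0 * X 2 - X 1 * X 1) := by
  obtain ⟨c, rfl⟩ := exists_conic hQ
  have hP : (Polynomial.C (c 0) + Polynomial.C (c 1) * Polynomial.X
      + Polynomial.C (c 2 + c 3) * Polynomial.X ^ 2 + Polynomial.C (c 4) * Polynomial.X ^ 3
      + Polynomial.C (c 5) * Polynomial.X ^ 4) = 0 := by
    refine Polynomial.funext fun ρ => ?_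
    have := h ρ
    rw [eval_conic] at this
    simp at this ⊢
    linear_combination this
  have key (n : ℕ) := congrArg (Polynomial.coeff · n) hP
  have h0 := key 0
  have h1 := key 1
  have h2 := key 2
  have h3 := key 3
  have h4 := key 4
  simp [Polynomial.coeff_X, Polynomial.coeff_C, Polynomial.coeff_X_pow, -map_add] at h0 h1 h2 h3 h4
  refine ⟨c 2, ?_⟩
  have : c 3 = -c 2 := by linear_combination h2
  simp [conic, h0, h1, this, h3, h4]
  ring

/-- A binary quartic form is a product of two binary quadratic forms. -/
lemma exists_mul_of_natDegree_le_four [IsAlgClosed K] (P : Polynomial K) (hP : P.natDegree ≤ 4) :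
    ∃ F G : Polynomial K, F.natDegree ≤ 2 ∧ G.natDegree ≤ 2 ∧ P = F * G := by
  rcases le_or_gt P.natDegree 2 with h | h
  · exact ⟨P, 1, h, by simp, by simp⟩
  · obtain ⟨x, hx⟩ := IsAlgClosed.exists_root P fun h0 => by
      have := Polynomial.natDegree_eq_zero_iff_degree_le_zero.2 h0.le
      omega
    obtain ⟨A, rfl⟩ := Polynomial.dvd_iff_isRoot.2 hx
    have hA0 : A ≠ 0 := by rintro rfl; simp at h
    rw [Polynomial.natDegree_mul (Polynomial.X_sub_C_ne_zero x) hA0,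
      Polynomial.natDegree_X_sub_C] at h hP
    obtain ⟨y, hy⟩ := IsAlgClosed.exists_root A fun h0 => by
      have := Polynomial.natDegree_eq_zero_iff_degree_le_zero.2 h0.le
      omega
    obtain ⟨B, rfl⟩ := Polynomial.dvd_iff_isRoot.2 hy
    have hB0 : B ≠ 0 := by rintro rfl; simp at hA0
    rw [Polynomial.natDegree_mul (Polynomial.X_sub_C_ne_zero y) hB0,
      Polynomial.natDegree_X_sub_C] at hP
    refine ⟨(Polynomial.X - Polynomial.C x) * (Polynomial.X - Polynomial.C y), B, ?_, by omega,
      by ring⟩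
    rw [Polynomial.natDegree_mul (Polynomial.X_sub_C_ne_zero x) (Polynomial.X_sub_C_ne_zero y),
      Polynomial.natDegree_X_sub_C, Polynomial.natDegree_X_sub_C]

/-- The pencil spanned by a nonsingular conic and any other conic contains a pair of lines: factor
the restriction of the second conic to the first one, which is a binary quartic. -/
lemma IsSmooth.exists_add_eq_lin_mul_lin [IsAlgClosed K] [CharZero K]
    {q Q : MvPolynomial (Fin 3) K} (hq : IsSmooth q) (hQ : Q.IsHomogeneous 2) :
    ∃ (k : K) (u v : Fin 3 → K), Q + C k * q = lin u * lin v := by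
  obtain ⟨M, hM, rfl⟩ := hq
  obtain ⟨c, hc⟩ := exists_conic (subst_isHomogeneous M⁻¹ hQ)
  obtain ⟨F, G, hF, hG, hFG⟩ := exists_mul_of_natDegree_le_four
    (Polynomial.C (c 0) + Polynomial.C (c 1) * Polynomial.X
      + Polynomial.C (c 2 + c 3) * Polynomial.X ^ 2 + Polynomial.C (c 4) * Polynomial.X ^ 3
      + Polynomial.C (c 5) * Polynomial.X ^ 4) (by compute_degree)
  obtain ⟨k, hk⟩ := conic_eq_of_vanishing (Q := lin (fun i => F.coeff i) * lin (fun i => G.coeff i)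
    - conic c) ((lin_mul_lin_isHomogeneous _ _).sub (conic_isHomogeneous c)) fun ρ => by
      have := congrArg (Polynomial.eval ρ) hFG
      rw [Polynomial.eval_mul, F.eval_eq_sum_range' (n := 3) (by omega),
        G.eval_eq_sum_range' (n := 3) (by omega)] at this
      simp [Finset.sum_range_succ] at this
      rw [map_sub, map_mul, eval_lin, eval_lin, eval_conic]
      simp
      linear_combination -this
  refine ⟨k, Matrix.vecMul (fun i : Fin 3 => F.coeff i) M,
    Matrix.vecMul (fun i : Fin 3 => G.coeff i) M, ?_⟩
  rw [← subst_lin, ← subst_lin, ← map_mul, sub_eq_iff_eq_add.1 hk, map_add, ← hc,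
    subst_subst_inv hM, add_comm, map_mul, algHom_C, algebraMap_eq]

/-- A nonsingular conic is only contained in its multiples. -/
lemma IsSmooth.exists_eval_ne_zero [Infinite K] {q Q : MvPolynomial (Fin 3) K} (hq : IsSmooth q)
    (hQ : Q.IsHomogeneous 2) (hne : ∀ k, Q ≠ C k * q) : ∃ p, eval p q = 0 ∧ eval p Q ≠ 0 := by
  obtain ⟨M, hM, rfl⟩ := hq
  by_contra! hcon
  obtain ⟨k, hk⟩ := conic_eq_of_vanishing (subst_isHomogeneous M⁻¹ hQ) fun ρ => by
    rw [eval_subst]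
    refine hcon _ ?_
    rw [eval_subst, Matrix.mulVec_mulVec, Matrix.mul_nonsing_inv _ (isUnit_iff_ne_zero.2 hM),
      Matrix.one_mulVec]
    simp
    ring
  refine hne k ?_
  rw [← subst_subst_inv hM Q, hk, map_mul, algHom_C, algebraMap_eq]

end PlaneQuartic

namespace PlaneQuartic

open Polynomial

variable {K : Type*} [Field K]

/-! ### Functionals on univariate polynomials -/

/-- Sylvester's theorem for functionals on univariate polynomials: a functional that kills the
multiples of degree at most `d` of a polynomial with simple roots is a combination of evaluations
at these roots on polynomials of degree at most `d`. -/
lemma eq_sum_eval_of_nodal (ψ : K[X] →ₗ[K] K) (s : Finset K) (d : ℕ)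
    (h : ∀ i, i + s.card ≤ d → ψ (Lagrange.nodal s id * X ^ i) = 0) :
    ∃ w : K → K, ∀ F : K[X], F.natDegree ≤ d → ψ F = ∑ ρ ∈ s, w ρ * F.eval ρ := by
  classical
  refine ⟨fun ρ => ψ (Lagrange.basis s id ρ), fun F hF => ?_⟩
  set G := Lagrange.nodal s (id : K → K) with hGdef
  have hG : G.Monic := Lagrange.nodal_monic
  have hGdeg : G.natDegree = s.card := Lagrange.natDegree_nodal
  have h1 : ψ (G * (F /ₘ G)) = 0 := by
    rw [(F /ₘ G).as_sum_range_C_mul_X_pow, Finset.mul_sum, map_sum]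
    refine Finset.sum_eq_zero fun i hi => ?_
    rw [mul_left_comm, ← smul_eq_C_mul, map_smul]
    by_cases hd : s.card ≤ F.natDegree
    · rw [h i, smul_zero]
      rw [Finset.mem_range, natDegree_divByMonic _ hG, hGdeg] at hi
      omega
    · have : F /ₘ G = 0 := by
        rw [divByMonic_eq_zero_iff hG]
        exact degree_lt_degree (by omega)
      rw [this, coeff_zero, zero_smul]
  have h2 : F %ₘ G = Lagrange.interpolate s id (fun ρ => F.eval ρ) := by
    refine Lagrange.eq_interpolate_of_eval_eq _ (Set.injOn_id _) ?_ fun ρ hρ => ?_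
    · rw [← Lagrange.degree_nodal (v := id)]
      exact degree_modByMonic_lt _ hG
    · have := congrArg (eval ρ) (modByMonic_add_div F G)
      rw [eval_add, eval_mul, hGdef, show ρ = id ρ from rfl,
        Lagrange.eval_nodal_at_node hρ] at this
      simpa using this
  conv_lhs => rw [← modByMonic_add_div F G, map_add, h1, add_zero, h2,
    Lagrange.interpolate_apply, map_sum]
  refine Finset.sum_congr rfl fun ρ _ => ?_
  rw [← smul_eq_C_mul, map_smul, smul_eq_mul, mul_comm]

/-- A member of the pencil spanned by `G` and `N` that has a double root at `ρ` makes the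
Wronskian of `G` and `N` vanish at `ρ`, so that all but finitely many members are squarefree. -/
lemma exists_nodal_in_pencil [IsAlgClosed K] [CharZero K] {G N : K[X]} (hG : G.Monic)
    (hpos : 0 < G.natDegree) (hN : N.degree < G.degree)
    (hcop : ∀ ρ, G.IsRoot ρ → ¬ N.IsRoot ρ) :
    ∃ (e : K) (s : Finset K), s.card = G.natDegree ∧ G + C e * N = Lagrange.nodal s id := by
  classical
  set W := G * derivative N - derivative G * N with hW
  have hco : IsCoprime G N := by
    rw [isCoprime_iff_aeval_ne_zero_of_isAlgClosed (k := K) (K := K)]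
    intro ρ
    by_cases h : G.IsRoot ρ
    · right; simpa using hcop ρ h
    · left; simpa using h
  have hW0 : W ≠ 0 := by
    intro h0
    have hd : G ∣ derivative G * N := ⟨derivative N, by rw [← sub_eq_zero.1 h0]⟩
    have hd' : G ∣ derivative G := hco.dvd_of_dvd_mul_right hd
    have : derivative G = 0 := by
      by_contra hne
      have := natDegree_le_of_dvd hd' hne
      have := natDegree_derivative_lt hpos.ne'
      omega
    exact hpos.ne' (derivative_eq_zero.1 this)
  obtain ⟨e, he⟩ := Infinite.exists_notMem_finset
    (W.roots.toFinset.image fun ρ => -(G.eval ρ / N.eval ρ))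
  set H := G + C e * N with hH
  have hlt : (C e * N).degree < G.degree := by
    refine lt_of_le_of_lt ?_ hN
    rw [← smul_eq_C_mul]
    exact degree_smul_le _ _
  have hHm : H.Monic := hG.add_of_left hlt
  have hHd : H.natDegree = G.natDegree := natDegree_add_eq_left_of_degree_lt hlt
  have hsep : H.Separable := by
    rw [Separable, isCoprime_iff_aeval_ne_zero_of_isAlgClosed (k := K) (K := K)]
    intro ρ
    by_contra! hcon
    obtain ⟨h1, h2⟩ := hcon
    simp only [coe_aeval_eq_eval, hH, eval_add, eval_mul, eval_C, derivative_add,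
      derivative_C_mul] at h1 h2
    have hNρ : N.eval ρ ≠ 0 := fun hz => hcop ρ (by simpa [hz] using h1) hz
    refine he (Finset.mem_image.2 ⟨ρ, ?_, ?_⟩)
    · rw [Multiset.mem_toFinset, mem_roots hW0, IsRoot, hW]
      simp only [eval_sub, eval_mul]
      linear_combination (eval ρ (derivative N)) * h1 - (eval ρ N) * h2
    · field_simp
      linear_combination -h1
  refine ⟨e, H.roots.toFinset, ?_, ?_⟩
  · rw [Multiset.toFinset_card_of_nodup (nodup_roots hsep), ← hHd]
    exact (IsAlgClosed.splits H).natDegree_eq_card_roots.symm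
  · rw [Lagrange.nodal_eq, Finset.prod, Multiset.toFinset_val,
      Multiset.dedup_eq_self.2 (nodup_roots hsep)]
    exact (IsAlgClosed.splits H).eq_prod_roots_of_monic hHm

/-- The functional on univariate polynomials with prescribed moments. -/
noncomputable def ofMoments (m : ℕ → K) : K[X] →ₗ[K] K :=
  (basisMonomials K).constr K m

lemma ofMoments_X_pow (m : ℕ → K) (n : ℕ) : ofMoments m (X ^ n) = m n := by
  have := (basisMonomials K).constr_basis K m n
  rw [X_pow_eq_monomial, ofMoments]
  simpa using this

lemma ofMoments_C_mul_X_pow (m : ℕ → K) (k : K) (n : ℕ) :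
    ofMoments m (C k * X ^ n) = k * m n := by
  rw [← smul_eq_C_mul, map_smul, ofMoments_X_pow, smul_eq_mul]

/-- If the Hankel form of `ψ` on polynomials of degree at most four is nondegenerate, then it takes
all values. -/
lemma exists_of_hankel_nondegenerate (ψ : K[X] →ₗ[K] K)
    (hψ : ∀ H : K[X], H.degree < 5 → (∀ i < 5, ψ (H * X ^ i) = 0) → H = 0)
    (y : ℕ → K) :
    ∃ H : K[X], H.degree < 5 ∧ ∀ i < 5, ψ (H * X ^ i) = y i := by
  let T : degreeLT K 5 →ₗ[K] (Fin 5 → K) := LinearMap.pi fun i =>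
    ψ ∘ₗ LinearMap.mulRight K (X ^ (i : ℕ)) ∘ₗ (degreeLT K 5).subtype
  have hT (H : degreeLT K 5) (i : Fin 5) :
      T H i = ψ ((H : K[X]) * X ^ (i : ℕ)) := rfl
  have : FiniteDimensional K (degreeLT K 5) :=
    (degreeLTEquiv K 5).symm.finiteDimensional
  have hinj : Function.Injective T := by
    rw [← LinearMap.ker_eq_bot, LinearMap.ker_eq_bot']
    intro H hH
    refine Subtype.ext (hψ H (mem_degreeLT.1 H.2) fun i hi => ?_)
    rw [← hT H ⟨i, hi⟩, hH]
    rfl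
  obtain ⟨H, hH⟩ := (LinearMap.injective_iff_surjective_of_finrank_eq_finrank
    (degreeLTEquiv K 5).finrank_eq).1 hinj fun i => y i
  refine ⟨H, mem_degreeLT.1 H.2, fun i hi => ?_⟩
  rw [← hT H ⟨i, hi⟩, hH]

/-- Sylvester's algorithm for binary octics with nondegenerate catalecticant: the quintics apolar
to such an octic form a pencil without base points, and a general member has five roots. -/
lemma exists_five_roots [IsAlgClosed K] [CharZero K] (ψ : K[X] →ₗ[K] K)
    (hψ : ∀ H : K[X], H.degree < 5 → (∀ i < 5, ψ (H * X ^ i) = 0) → H = 0) :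
    ∃ s : Finset K, s.card = 5 ∧ ∀ i, i + s.card ≤ 8 → ψ (Lagrange.nodal s id * X ^ i) = 0 := by
  obtain ⟨H, hHd, hH⟩ := exists_of_hankel_nondegenerate ψ hψ fun i =>
    if i < 4 then -ψ (X ^ (5 + i)) else 0
  obtain ⟨N, hNd, hN⟩ := exists_of_hankel_nondegenerate ψ hψ fun i => if i < 4 then 0 else 1
  have hN0 : N ≠ 0 := by
    rintro rfl
    simpa using hN 4 (by norm_num)
  have hlt : H.degree < (X ^ 5 : K[X]).degree := by rw [degree_X_pow]; exact_mod_cast hHd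
  have hG : (X ^ 5 + H).Monic := (monic_X_pow 5).add_of_left hlt
  have hGd : (X ^ 5 + H).degree = 5 := by
    rw [degree_add_eq_left_of_degree_lt hlt, degree_X_pow]; rfl
  have hGn : (X ^ 5 + H).natDegree = 5 := natDegree_eq_of_degree_eq_some hGd
  have hGk (i : ℕ) (hi : i < 4) : ψ ((X ^ 5 + H) * X ^ i) = 0 := by
    rw [add_mul, map_add, hH i (by omega), if_pos hi, ← pow_add, add_neg_cancel]
  have hNk (i : ℕ) (hi : i < 4) : ψ (N * X ^ i) = 0 := by
    rw [hN i (by omega), if_pos hi]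
  -- If `(X - ρ) * A` kills `1, X, X², X³`, then `A` acts as a multiple of evaluation at `ρ`.
  have hstep {A G : K[X]} {ρ : K} (hA : G = (X - C ρ) * A) (hGk : ∀ i < 4, ψ (G * X ^ i) = 0) :
      ∀ i < 5, ψ (A * X ^ i) = ρ ^ i * ψ A := by
    intro i
    induction i with
    | zero => simp
    | succ i ih =>
      intro hi
      have h1 := hGk i (by omega)
      rw [hA, show (X - C ρ) * A * X ^ i = A * X ^ (i + 1) - C ρ * (A * X ^ i) by ring, map_sub,
        ← smul_eq_C_mul, map_smul, ih (by omega), smul_eq_mul] at h1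
      rw [sub_eq_zero.1 h1]
      ring
  obtain ⟨e, s, hs, hes⟩ := exists_nodal_in_pencil hG (by omega) (hGd ▸ hNd) fun ρ hGρ hNρ => by
    obtain ⟨A, hA⟩ := dvd_iff_isRoot.2 hGρ
    obtain ⟨B, hB⟩ := dvd_iff_isRoot.2 hNρ
    have hA0 : A ≠ 0 := by rintro rfl; simp [hA] at hGn
    have hB0 : B ≠ 0 := by rintro rfl; simp at hB; exact hN0 hB
    have hAd : A.natDegree = 4 := by
      rw [hA, natDegree_mul (X_sub_C_ne_zero ρ) hA0, natDegree_X_sub_C] at hGn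
      omega
    have hBd : B.natDegree < 4 := by
      have : N.natDegree < 5 := (natDegree_lt_iff_degree_lt hN0).2 (by exact_mod_cast hNd)
      rw [hB, natDegree_mul (X_sub_C_ne_zero ρ) hB0, natDegree_X_sub_C] at this
      omega
    have hlin : C (ψ B) * A - C (ψ A) * B = 0 := by
      refine hψ _ ?_ fun i hi => ?_
      · refine lt_of_le_of_lt (degree_le_of_natDegree_le (n := 4) ?_) (by norm_num)
        exact (natDegree_sub_le_of_le ((natDegree_C_mul_le _ _).trans hAd.le)
          ((natDegree_C_mul_le _ _).trans hBd.le)).trans (max_self 4).le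
      · rw [sub_mul, map_sub, mul_assoc, mul_assoc, ← smul_eq_C_mul, ← smul_eq_C_mul, map_smul,
          map_smul, hstep hA hGk i hi, hstep hB hNk i hi, smul_eq_mul, smul_eq_mul]
        ring
    have hψB : ψ B = 0 := by
      have := congrArg (coeff · 4) hlin
      simp only [coeff_sub, coeff_C_mul, coeff_zero, coeff_eq_zero_of_natDegree_lt hBd, mul_zero,
        sub_zero, mul_eq_zero] at this
      refine this.resolve_right fun h => hA0 ?_
      rw [← leadingCoeff_eq_zero, leadingCoeff, hAd, h]
    have hB5 : B.degree < (5 : ℕ) := (natDegree_lt_iff_degree_lt hB0).1 (by omega)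
    refine hB0 (hψ B (by exact_mod_cast hB5) fun i hi => ?_)
    rw [hstep hB hNk i hi, hψB, mul_zero]
  refine ⟨s, hs.trans hGn, fun i hi => ?_⟩
  rw [hs, hGn] at hi
  rw [← hes, add_mul, map_add, hGk i (by omega), mul_assoc, ← smul_eq_C_mul, map_smul,
    hNk i (by omega), smul_zero, add_zero]

end PlaneQuartic

namespace PlaneQuartic

open MvPolynomial

variable {K : Type*} [Field K]

/-! ### Decompositions from moments -/

lemma eval_monomial_three (p : Fin 3 → K) (a b c : ℕ) :
    eval p (X 0 ^ a * X 1 ^ b * X 2 ^ c : MvPolynomial (Fin 3) K)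
      = p 0 ^ a * p 1 ^ b * p 2 ^ c := by
  simp

lemma hasDecomp_of_list {φ : MvPolynomial (Fin 3) K →ₗ[K] K} (l : List (K × (Fin 3 → K)))
    (h : ∀ a b c : ℕ, a + b + c = 4 → φ (X 0 ^ a * X 1 ^ b * X 2 ^ c)
      = (l.map fun q => q.1 * (q.2 0 ^ a * q.2 1 ^ b * q.2 2 ^ c)).sum) :
    HasDecomp φ l.length := by
  refine ⟨l, le_rfl, fun F hF => ?_⟩
  have hsum (l : List (K × (Fin 3 → K))) (F : MvPolynomial (Fin 3) K) :
      (l.map fun q => q.1 • evalAt q.2).sum F = (l.map fun q => q.1 * eval q.2 F).sum := by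
    induction l with
    | nil => simp
    | cons q l ih => simp [ih]
  rw [← hsum]
  refine eq_on_quartics (fun a b c habc => ?_) hF
  simp only [h a b c habc, hsum, eval_monomial_three]

lemma hasDecomp_of_finset {ι : Type*} {φ : MvPolynomial (Fin 3) K →ₗ[K] K} (s : Finset ι)
    (w : ι → K) (p : ι → Fin 3 → K)
    (h : ∀ a b c : ℕ, a + b + c = 4 → φ (X 0 ^ a * X 1 ^ b * X 2 ^ c)
      = ∑ i ∈ s, w i * (p i 0 ^ a * p i 1 ^ b * p i 2 ^ c)) :
    HasDecomp φ s.card := by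
  have := hasDecomp_of_list (φ := φ) (s.toList.map fun i => (w i, p i)) fun a b c habc => by
    rw [h a b c habc, List.map_map, ← Finset.sum_map_toList]
    rfl
  simpa using this

/-! ### Quartics apolar to a nonsingular conic -/

/-- A quartic monomial that restricts to `T ^ n` under `T ↦ (1, T, T²)`, for `n ≤ 8`. -/
noncomputable def conicMonomial (n : ℕ) : MvPolynomial (Fin 3) K :=
  X 0 ^ (4 - (n + 1) / 2) * X 1 ^ (n % 2) * X 2 ^ (n / 2)

/-- A functional apolar to `X₀X₂ - X₁²` only depends on the restriction of quartic forms to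
this conic, which is parametrized by `T ↦ (1, T, T²)`. -/
lemma apply_monomial_of_apolar {φ : MvPolynomial (Fin 3) K →ₗ[K] K}
    (h : Apolar φ (X 0 * X 2 - X 1 * X 1)) (a b c : ℕ) (habc : a + b + c = 4) :
    φ (X 0 ^ a * X 1 ^ b * X 2 ^ c) = φ (conicMonomial (b + 2 * c)) := by
  induction b using Nat.strong_induction_on generalizing a c with
  | _ b ih =>
    rcases lt_or_ge b 2 with hb | hb
    · rw [conicMonomial, show (b + 2 * c) % 2 = b by omega, show (b + 2 * c) / 2 = c by omega,
        show 4 - (b + 2 * c + 1) / 2 = a by omega]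
    · obtain ⟨b, rfl⟩ := Nat.exists_eq_add_of_le' hb
      have hR : (X 0 ^ a * X 1 ^ b * X 2 ^ c : MvPolynomial (Fin 3) K).IsHomogeneous 2 := by
        have := ((isHomogeneous_X_pow (R := K) (0 : Fin 3) a).mul
          (isHomogeneous_X_pow (1 : Fin 3) b)).mul (isHomogeneous_X_pow (2 : Fin 3) c)
        rwa [show a + b + c = 2 by omega] at this
      have h1 := h.2 _ hR
      have h2 := ih b (by omega) (a + 1) (c + 1) (by omega)
      rw [show b + 2 + 2 * c = b + 2 * (c + 1) by ring, ← h2, eq_comm, ← sub_eq_zero, ← map_sub,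
        ← h1]
      congr 1
      ring

/-- A quartic whose only apolar conic is `X₀X₂ - X₁²` is a sum of five fourth powers. -/
lemma hasDecomp_five_of_standard_conic [IsAlgClosed K] [CharZero K]
    {φ : MvPolynomial (Fin 3) K →ₗ[K] K} (hq : Apolar φ (X 0 * X 2 - X 1 * X 1))
    (hall : ∀ Q, Apolar φ Q → ∃ k, Q = C k * (X 0 * X 2 - X 1 * X 1)) : HasDecomp φ 5 := by
  set ψ := ofMoments fun n => φ (conicMonomial n) with hψdef
  have hmon (a b c : ℕ) (habc : a + b + c = 4) :
      φ (X 0 ^ a * X 1 ^ b * X 2 ^ c) = ψ (Polynomial.X ^ (b + 2 * c)) := by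
    rw [apply_monomial_of_apolar hq a b c habc, hψdef, ofMoments_X_pow]
  have hθ : ∀ F : MvPolynomial (Fin 3) K, F.IsHomogeneous 4 →
      φ F = ψ (aeval ![1, Polynomial.X, Polynomial.X ^ 2] F) := fun F hF =>
    eq_on_quartics (χ := ψ ∘ₗ (aeval ![1, Polynomial.X, Polynomial.X ^ 2]).toLinearMap)
      (fun a b c habc => by
        rw [hmon a b c habc]
        simp [← pow_mul, ← pow_add]) hF
  have hψ : ∀ H : Polynomial K, H.degree < 5 → (∀ i < 5, ψ (H * Polynomial.X ^ i) = 0) →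
      H = 0 := by
    intro H hH h
    set c : Fin 6 → K := ![H.coeff 0, H.coeff 1, H.coeff 2, 0, H.coeff 3, H.coeff 4] with hc
    have hcH : aeval ![1, Polynomial.X, Polynomial.X ^ 2] (conic c) = H := by
      conv_rhs => rw [H.as_sum_range' 5 (by
        rcases eq_or_ne H 0 with rfl | h0
        · simp
        · exact (Polynomial.natDegree_lt_iff_degree_lt h0).2 hH)]
      simp [conic, hc, Finset.sum_range_succ, ← Polynomial.C_mul_X_pow_eq_monomial]
      ring
    have hap : Apolar φ (conic c) := by
      have key (i j : Fin 3) (n : ℕ) (hn : n < 5)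
          (hij : aeval ![(1 : Polynomial K), Polynomial.X, Polynomial.X ^ 2]
            (X i * X j : MvPolynomial (Fin 3) K) = Polynomial.X ^ n) :
          φ (conic c * (X i * X j)) = 0 := by
        rw [hθ _ ((conic_isHomogeneous c).mul (isHomogeneous_X_mul_X i j)), map_mul,
          hcH, hij, h n hn]
      exact apolar_of_monomials (conic_isHomogeneous c) (key 0 0 0 (by norm_num) (by simp))
        (key 0 1 1 (by norm_num) (by simp)) (key 0 2 2 (by norm_num) (by simp))
        (key 1 1 2 (by norm_num) (by simp; ring)) (key 1 2 3 (by norm_num) (by simp; ring))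
        (key 2 2 4 (by norm_num) (by simp; ring))
    obtain ⟨k, hk⟩ := hall _ hap
    have hck : c = k • ![0, 0, 1, -1, 0, 0] := by
      refine conic_injective ?_
      rw [hk, conic_smul]
      simp [conic]
      left
      ring
    have hk0 : k = 0 := by simpa [hc] using (congrFun hck 3).symm
    rw [← hcH, hck, hk0, zero_smul]
    simp [conic]
  obtain ⟨s, hs, hker⟩ := exists_five_roots ψ hψ
  obtain ⟨w, hw⟩ := eq_sum_eval_of_nodal ψ s 8 hker
  rw [← hs]
  refine hasDecomp_of_finset s w (fun ρ => ![1, ρ, ρ ^ 2]) fun a b c habc => ?_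
  rw [hmon a b c habc, hw _ (by rw [Polynomial.natDegree_X_pow]; omega)]
  refine Finset.sum_congr rfl fun ρ _ => ?_
  simp [← pow_mul, ← pow_add]

end PlaneQuartic

namespace PlaneQuartic

/-! ### Binary quartics -/

section Binary

open Polynomial

variable {K : Type*} [Field K]

/-- The binary quartic with moments `m` is a combination of at most `r` fourth powers of linear
forms: `m k = ∑ w * x ^ k * y ^ (4 - k)`, the sum being over the list of triples `(w, x, y)`. -/
def IsBinarySum (m : ℕ → K) (r : ℕ) : Prop :=
  ∃ l : List (K × K × K), l.length ≤ r ∧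
    ∀ k ≤ 4, m k = (l.map fun q => q.1 * (q.2.1 ^ k * q.2.2 ^ (4 - k))).sum

/-- The sequence of moments `m₀, m₁, m₂, m₃, v`. -/
def moments (m₀ m₁ m₂ m₃ v : K) : ℕ → K
  | 0 => m₀
  | 1 => m₁
  | 2 => m₂
  | 3 => m₃
  | _ => v

lemma quadratic_ne_zero {a b c : K} (h : a ≠ 0 ∨ b ≠ 0 ∨ c ≠ 0) :
    C a * X ^ 2 + C b * X + C c ≠ 0 := by
  intro h0
  have key (n : ℕ) := congrArg (coeff · n) h0
  have h2 := key 2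
  have h1 := key 1
  have hc := key 0
  simp [coeff_X, coeff_C, coeff_X_pow] at h2 h1 hc
  simp [h2, h1, hc] at h

lemma exists_eval_ne_zero [Infinite K] {P : K[X]} (hP : P ≠ 0) : ∃ x, P.eval x ≠ 0 := by
  by_contra! h
  exact hP (Polynomial.funext fun x => by rw [h x, eval_zero])

/-- A binary quartic whose first four moments are those of a multiple of a fourth power needs at
most two summands, the second one being the evaluation at infinity, which only changes the last
moment. -/
lemma isBinarySum_of_geometric (w σ v : K) :
    IsBinarySum (moments w (w * σ) (w * σ ^ 2) (w * σ ^ 3) v) 3 := by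
  refine ⟨[(w, σ, 1), (v - w * σ ^ 4, 1, 0)], by simp, fun k hk => ?_⟩
  interval_cases k <;> simp [moments]

/-- Sylvester's theorem with three nodes `ρ, x, y`: the hypotheses say that the contraction of the
quartic with the linear form vanishing at `ρ` is apolar to the quadratic form with roots `x, y`. -/
lemma isBinarySum_of_roots {m₀ m₁ m₂ m₃ v ρ x y : K} (hx : ρ ≠ x) (hy : ρ ≠ y) (hxy : x ≠ y)
    (h0 : (m₃ - ρ * m₂) - (x + y) * (m₂ - ρ * m₁) + x * y * (m₁ - ρ * m₀) = 0)
    (h1 : (v - ρ * m₃) - (x + y) * (m₃ - ρ * m₂) + x * y * (m₂ - ρ * m₁) = 0) :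
    IsBinarySum (moments m₀ m₁ m₂ m₃ v) 3 := by
  classical
  have hcard : ({ρ, x, y} : Finset K).card = 3 := Finset.card_eq_three.2 ⟨ρ, x, y, hx, hy, hxy, rfl⟩
  have hnodal : Lagrange.nodal {ρ, x, y} id
      = X ^ 3 - C (ρ + x + y) * X ^ 2 + C (ρ * x + ρ * y + x * y) * X ^ 1
        - C (ρ * x * y) * X ^ 0 := by
    rw [Lagrange.nodal_eq, Finset.prod_insert (by simp [hx, hy]), Finset.prod_pair hxy]
    simp only [id, C_add, C_mul]
    ring
  obtain ⟨w, hw⟩ := eq_sum_eval_of_nodal (ofMoments (moments m₀ m₁ m₂ m₃ v)) {ρ, x, y} 4 (by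
    intro i hi
    have hi' : i ≤ 1 := by omega
    rw [hnodal, sub_mul, add_mul, sub_mul, mul_assoc, mul_assoc, mul_assoc, ← pow_add, ← pow_add,
      ← pow_add, ← pow_add, map_sub, map_add, map_sub, ofMoments_X_pow, ofMoments_C_mul_X_pow,
      ofMoments_C_mul_X_pow, ofMoments_C_mul_X_pow]
    interval_cases i
    · simp only [moments]
      linear_combination h0
    · simp only [moments]
      linear_combination h1)
  refine ⟨[(w ρ, ρ, 1), (w x, x, 1), (w y, y, 1)], by simp, fun k hk => ?_⟩
  have := hw (X ^ k) (by rwa [natDegree_X_pow])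
  rw [ofMoments_X_pow, Finset.sum_insert (by simp [hx, hy]), Finset.sum_pair hxy] at this
  simpa using this

/-- A binary quartic that is not of the form `x³ * l`, with `l` not proportional to `x`, becomes a
sum of three fourth powers after adding a general multiple of `x⁴`. -/
lemma exists_isBinarySum_three [IsAlgClosed K] [CharZero K] (m₀ m₁ m₂ m₃ : K)
    (h : m₀ = 0 → m₁ = 0 → m₂ = 0 → m₃ = 0) :
    ∃ bad : Finset K, ∀ v ∉ bad, IsBinarySum (moments m₀ m₁ m₂ m₃ v) 3 := by
  classical
  by_cases hdep : m₀ * m₂ - m₁ ^ 2 = 0 ∧ m₁ * m₂ - m₀ * m₃ = 0 ∧ m₁ * m₃ - m₂ ^ 2 = 0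
  · -- The moments `m₀, m₁, m₂, m₃` form a geometric sequence.
    refine ⟨∅, fun v _ => ?_⟩
    obtain ⟨d1, d2, d3⟩ := hdep
    by_cases h0 : m₀ = 0
    · have h1 : m₁ = 0 := by
        rw [h0] at d1
        exact pow_eq_zero_iff two_ne_zero |>.1 (by linear_combination -d1)
      have h2 : m₂ = 0 := by
        rw [h1] at d3
        exact pow_eq_zero_iff two_ne_zero |>.1 (by linear_combination -d3)
      have := isBinarySum_of_geometric 0 0 v
      simpa [h h0 h1 h2, h0, h1, h2] using this
    · have e1 : m₀ * (m₁ / m₀) = m₁ := by field_simp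
      have e2 : m₀ * (m₁ / m₀) ^ 2 = m₂ := by field_simp; linear_combination -d1
      have e3 : m₀ * (m₁ / m₀) ^ 3 = m₃ := by
        field_simp; linear_combination -m₁ * d1 + m₀ * d2
      have := isBinarySum_of_geometric m₀ (m₁ / m₀) v
      rwa [e1, e2, e3] at this
  · have hne : m₀ ≠ 0 ∨ -(2 * m₁) ≠ 0 ∨ m₂ ≠ 0 := by
      by_contra! hcon
      obtain ⟨h0, h1, h2⟩ := hcon
      have h1 : m₁ = 0 := by simpa using h1
      exact hdep (by simp [h0, h1, h2])
    have hdep' : m₀ * m₂ - m₁ ^ 2 ≠ 0 ∨ m₁ * m₂ - m₀ * m₃ ≠ 0 ∨ m₁ * m₃ - m₂ ^ 2 ≠ 0 := by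
      by_contra! hcon
      exact hdep hcon
    obtain ⟨ρ, hρ⟩ := exists_eval_ne_zero
      (mul_ne_zero (quadratic_ne_zero hdep') (quadratic_ne_zero hne))
    simp only [eval_mul, eval_add, eval_C, eval_pow, eval_X, mul_ne_zero_iff] at hρ
    obtain ⟨hD, hr⟩ := hρ
    -- Moments of the cubic form obtained by contracting with the linear form vanishing at `ρ`.
    set n₀ := m₁ - ρ * m₀ with hn₀
    set n₁ := m₂ - ρ * m₁ with hn₁
    set n₂ := m₃ - ρ * m₂ with hn₂
    set D := n₀ * n₂ - n₁ ^ 2 with hDdef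
    replace hD : D ≠ 0 := by
      intro h0
      apply hD
      rw [← h0, hDdef, hn₀, hn₁, hn₂]
      ring
    -- The nodes `x`, `y` will be the roots of the quadratic form apolar to the cubic form with
    -- moments `n₀, n₁, n₂, n₃`, where `n₃ = v - ρ * m₃`. Up to nonzero factors, `A` gives its
    -- discriminant and `B` its value at `ρ`, as polynomials in `n₃`.
    set A : K[X] := C (n₀ ^ 2) * X ^ 2 + C (-(2 * n₀ * n₁ * n₂) - 4 * D * n₁) * X
        + C (n₁ ^ 2 * n₂ ^ 2 + 4 * D * n₂ ^ 2)
      with hAdef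
    have hA : A ≠ 0 := by
      refine quadratic_ne_zero ?_
      by_cases h0 : n₀ = 0
      · right; left
        have h1 : n₁ ≠ 0 := by
          rintro h1
          rw [h0, h1] at hDdef
          simp [hDdef] at hD
        simp [h0, h1, hD]
      · left
        exact pow_ne_zero _ h0
    set B : K[X] := C 0 * X ^ 2 + C (n₁ - ρ * n₀) * X + C (ρ ^ 2 * D + ρ * (n₁ * n₂) - n₂ ^ 2)
      with hBdef
    have hB : B ≠ 0 := by
      refine quadratic_ne_zero (Or.inr (Or.inl ?_))
      rw [hn₀, hn₁]
      convert hr using 1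
      ring
    refine ⟨(A * B).roots.toFinset.image (· + ρ * m₃), fun v hv => ?_⟩
    set n₃ := v - ρ * m₃ with hn₃
    have hn₃' : n₃ ∉ (A * B).roots := fun hmem =>
      hv (Finset.mem_image.2 ⟨n₃, Multiset.mem_toFinset.2 hmem, by rw [hn₃]; ring⟩)
    rw [mem_roots (mul_ne_zero hA hB), IsRoot] at hn₃'
    simp only [hAdef, hBdef, eval_mul, eval_add, eval_C, eval_pow, eval_X, mul_eq_zero,
      not_or] at hn₃'
    obtain ⟨hA', hB'⟩ := hn₃'
    set e₁ := (n₀ * n₃ - n₁ * n₂) / D with he₁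
    set e₂ := (n₁ * n₃ - n₂ ^ 2) / D with he₂
    obtain ⟨δ, hδ⟩ := IsAlgClosed.exists_eq_mul_self (discrim 1 (-e₁) e₂)
    obtain ⟨x, hx⟩ := exists_quadratic_eq_zero one_ne_zero ⟨δ, hδ⟩
    have hxe : x * (e₁ - x) = e₂ := by linear_combination -hx
    have hdisc : D ^ 2 * (e₁ ^ 2 - 4 * e₂) = n₀ ^ 2 * n₃ ^ 2
        + (-(2 * n₀ * n₁ * n₂) - 4 * D * n₁) * n₃ + (n₁ ^ 2 * n₂ ^ 2 + 4 * D * n₂ ^ 2) := by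
      rw [he₁, he₂]; field_simp; ring
    have hroot : D * (ρ ^ 2 - e₁ * ρ + e₂) = 0 * n₃ ^ 2 + (n₁ - ρ * n₀) * n₃
        + (ρ ^ 2 * D + ρ * (n₁ * n₂) - n₂ ^ 2) := by
      rw [he₁, he₂]; field_simp; ring
    refine isBinarySum_of_roots (ρ := ρ) (x := x) (y := e₁ - x) ?_ ?_ ?_ ?_ ?_
    · rintro rfl
      exact hB' (by rw [← hroot, ← hxe]; ring)
    · intro hρ
      refine hB' ?_
      rw [← hroot, ← hxe, show e₁ = ρ + x by rw [hρ]; ring]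
      ring
    · intro hxy
      refine hA' ?_
      rw [← hdisc, ← hxe, show e₁ = x + x by linear_combination -hxy]
      ring
    · rw [← hn₂, ← hn₁, ← hn₀, hxe, add_sub_cancel, he₁, he₂]
      field_simp
      rw [hDdef]
      ring
    · rw [← hn₃, ← hn₂, ← hn₁, hxe, add_sub_cancel, he₁, he₂]
      field_simp
      rw [hDdef]
      ring

/-- A binary quartic `x³ * l` is a sum of four fourth powers: up to scaling,
`192 x³ y = (y + 3x)⁴ - 3 (y + x)⁴ + 3 (y - x)⁴ - (y - 3x)⁴`. -/
lemma isBinarySum_four [CharZero K] (k v : K) : IsBinarySum (moments 0 0 0 k (k * v)) 4 := by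
  refine ⟨[(k / 48, v / 4 + 3, 1), (-(3 * k / 48), v / 4 + 1, 1), (3 * k / 48, v / 4 - 1, 1),
    (-(k / 48), v / 4 - 3, 1)], by simp, fun j hj => ?_⟩
  interval_cases j <;> simp [moments] <;> ring

end Binary

/-! ### Quartics apolar to a pair of lines -/

open MvPolynomial

variable {K : Type*} [Field K]

lemma apply_mixed_monomial {φ : MvPolynomial (Fin 3) K →ₗ[K] K} (h : Apolar φ (X 1 * X 2))
    (a b c : ℕ) (habc : a + b + c = 4) (hb : 0 < b) (hc : 0 < c) :
    φ (X 0 ^ a * X 1 ^ b * X 2 ^ c) = 0 := by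
  obtain ⟨b, rfl⟩ := Nat.exists_eq_succ_of_ne_zero hb.ne'
  obtain ⟨c, rfl⟩ := Nat.exists_eq_succ_of_ne_zero hc.ne'
  have hR : (X 0 ^ a * X 1 ^ b * X 2 ^ c : MvPolynomial (Fin 3) K).IsHomogeneous 2 := by
    have := ((isHomogeneous_X_pow (R := K) (0 : Fin 3) a).mul
      (isHomogeneous_X_pow (1 : Fin 3) b)).mul (isHomogeneous_X_pow (2 : Fin 3) c)
    rwa [show a + b + c = 2 by omega] at this
  have h1 := h.2 _ hR
  rw [show (X 0 ^ a * X 1 ^ (b + 1) * X 2 ^ (c + 1) : MvPolynomial (Fin 3) K)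
    = X 1 * X 2 * (X 0 ^ a * X 1 ^ b * X 2 ^ c) by ring, h1]

/-- A functional that kills `X₁X₂` splits into one on forms in `X₀, X₁` and one on forms in
`X₀, X₂`. Only the sum of their values at `X₀⁴` is determined. -/
lemma hasDecomp_of_isBinarySum {φ : MvPolynomial (Fin 3) K →ₗ[K] K}
    (h : Apolar φ (X 1 * X 2)) {m n : ℕ → K} {r s : ℕ}
    (hm : IsBinarySum m r) (hn : IsBinarySum n s)
    (hφm : ∀ k < 4, φ (X 0 ^ k * X 1 ^ (4 - k) * X 2 ^ 0) = m k)
    (hφn : ∀ k < 4, φ (X 0 ^ k * X 1 ^ 0 * X 2 ^ (4 - k)) = n k)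
    (hφ : φ (X 0 ^ 4 * X 1 ^ 0 * X 2 ^ 0) = m 4 + n 4) : HasDecomp φ (r + s) := by
  obtain ⟨l, hl, hlm⟩ := hm
  obtain ⟨l', hl', hln⟩ := hn
  refine (hasDecomp_of_list (l.map (fun q => (q.1, ![q.2.1, q.2.2, 0]))
    ++ l'.map (fun q => (q.1, ![q.2.1, 0, q.2.2]))) fun a b c habc => ?_).mono (by
      simpa using Nat.add_le_add hl hl')
  simp only [List.map_append, List.map_map, List.sum_append, Function.comp_def,
    Matrix.cons_val_zero, Matrix.cons_val_one, Matrix.cons_val]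
  rcases Nat.eq_zero_or_pos b with rfl | hb <;> rcases Nat.eq_zero_or_pos c with rfl | hc
  · obtain rfl : a = 4 := by omega
    rw [hφ, hlm 4 le_rfl, hln 4 le_rfl]
    simp
  · obtain rfl : c = 4 - a := by omega
    rw [hφn a (by omega), hln a (by omega)]
    simp [hc.ne']
  · obtain rfl : b = 4 - a := by omega
    rw [hφm a (by omega), hlm a (by omega)]
    simp [hb.ne']
  · rw [apply_mixed_monomial h a b c habc hb hc]
    simp [hb.ne', hc.ne']

section

variable [IsAlgClosed K] [CharZero K] {φ : MvPolynomial (Fin 3) K →ₗ[K] K}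

/-- A quartic apolar to `X₁X₂` is the sum of a quartic form in two variables `x`, `y` and one in
`x`, `z`; this is the case in which neither is divisible by `x³`. -/
lemma hasDecomp_six_of_line_pair (h : Apolar φ (X 1 * X 2))
    (h1 : φ (X 0 ^ 0 * X 1 ^ 4 * X 2 ^ 0) = 0 → φ (X 0 ^ 1 * X 1 ^ 3 * X 2 ^ 0) = 0 →
      φ (X 0 ^ 2 * X 1 ^ 2 * X 2 ^ 0) = 0 → φ (X 0 ^ 3 * X 1 ^ 1 * X 2 ^ 0) = 0)
    (h2 : φ (X 0 ^ 0 * X 1 ^ 0 * X 2 ^ 4) = 0 → φ (X 0 ^ 1 * X 1 ^ 0 * X 2 ^ 3) = 0 →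
      φ (X 0 ^ 2 * X 1 ^ 0 * X 2 ^ 2) = 0 → φ (X 0 ^ 3 * X 1 ^ 0 * X 2 ^ 1) = 0) :
    HasDecomp φ 6 := by
  classical
  obtain ⟨S, hS⟩ := exists_isBinarySum_three _ _ _ _ h1
  obtain ⟨T, hT⟩ := exists_isBinarySum_three _ _ _ _ h2
  set t := φ (X 0 ^ 4 * X 1 ^ 0 * X 2 ^ 0) with ht
  obtain ⟨v, hv⟩ := Infinite.exists_notMem_finset (S ∪ T.image (t - ·))
  rw [Finset.mem_union, not_or] at hv
  refine hasDecomp_of_isBinarySum h (hS v hv.1) (hT (t - v) fun hmem => hv.2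
    (Finset.mem_image.2 ⟨_, hmem, sub_sub_cancel t v⟩)) ?_ ?_ ?_
  · intro k hk
    interval_cases k <;> rfl
  · intro k hk
    interval_cases k <;> rfl
  · simp only [moments]
    rw [← ht]
    ring

/-- A quartic with a pair of distinct lines as an apolar conic is a sum of seven fourth powers. -/
lemma hasDecomp_seven_of_line_pair (h : Apolar φ (X 1 * X 2)) : HasDecomp φ 7 := by
  classical
  set t := φ (X 0 ^ 4 * X 1 ^ 0 * X 2 ^ 0) with ht
  have bad {m₀ m₁ m₂ m₃ : K} (h : ¬(m₀ = 0 → m₁ = 0 → m₂ = 0 → m₃ = 0)) (v : K) :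
      IsBinarySum (moments m₀ m₁ m₂ m₃ v) 4 := by
    push Not at h
    obtain ⟨rfl, rfl, rfl, h⟩ := h
    have := isBinarySum_four m₃ (v / m₃)
    rwa [mul_div_cancel₀ _ h] at this
  by_cases h1 : φ (X 0 ^ 0 * X 1 ^ 4 * X 2 ^ 0) = 0 → φ (X 0 ^ 1 * X 1 ^ 3 * X 2 ^ 0) = 0 →
      φ (X 0 ^ 2 * X 1 ^ 2 * X 2 ^ 0) = 0 → φ (X 0 ^ 3 * X 1 ^ 1 * X 2 ^ 0) = 0 <;>
    by_cases h2 : φ (X 0 ^ 0 * X 1 ^ 0 * X 2 ^ 4) = 0 → φ (X 0 ^ 1 * X 1 ^ 0 * X 2 ^ 3) = 0 →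
      φ (X 0 ^ 2 * X 1 ^ 0 * X 2 ^ 2) = 0 → φ (X 0 ^ 3 * X 1 ^ 0 * X 2 ^ 1) = 0
  · exact (hasDecomp_six_of_line_pair h h1 h2).mono (by norm_num)
  · obtain ⟨S, hS⟩ := exists_isBinarySum_three _ _ _ _ h1
    obtain ⟨v, hv⟩ := Infinite.exists_notMem_finset S
    refine hasDecomp_of_isBinarySum h (hS v hv) (bad h2 (t - v)) ?_ ?_ ?_
    · intro k hk
      interval_cases k <;> rfl
    · intro k hk
      interval_cases k <;> rfl
    · simp only [moments]
      rw [← ht]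
      ring
  · obtain ⟨S, hS⟩ := exists_isBinarySum_three _ _ _ _ h2
    obtain ⟨v, hv⟩ := Infinite.exists_notMem_finset S
    refine hasDecomp_of_isBinarySum (r := 4) (s := 3) h (bad h1 (t - v)) (hS v hv) ?_ ?_ ?_
    · intro k hk
      interval_cases k <;> rfl
    · intro k hk
      interval_cases k <;> rfl
    · simp only [moments]
      rw [← ht]
      ring
  · -- The quartic is `x³ * l` for a linear form `l`, hence binary.
    push Not at h1 h2
    obtain ⟨a0, a1, a2, a3⟩ := h1
    obtain ⟨b0, b1, b2, b3⟩ := h2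
    set α := φ (X 0 ^ 3 * X 1 ^ 1 * X 2 ^ 0) with hα
    set β := φ (X 0 ^ 3 * X 1 ^ 0 * X 2 ^ 1) with hβ
    obtain ⟨l, hl, hm⟩ := isBinarySum_four (1 : K) t
    have hm' (a b c : ℕ) (habc : a + b + c = 4) :
        (l.map fun q => q.1 * (q.2.1 ^ a * (q.2.2 * α) ^ b * (q.2.2 * β) ^ c)).sum
          = moments 0 0 0 1 t a * (α ^ b * β ^ c) := by
      have := hm a (by omega)
      rw [one_mul] at this
      rw [this, ← List.sum_map_mul_right, show 4 - a = b + c by omega]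
      congr 1
      refine List.map_congr_left fun q _ => ?_
      ring
    refine (hasDecomp_of_list (l.map (fun q => (q.1, ![q.2.1, q.2.2 * α, q.2.2 * β])))
      fun a b c habc => ?_).mono (by simp; omega)
    simp only [List.map_map, Function.comp_def, Matrix.cons_val_zero, Matrix.cons_val_one,
      Matrix.cons_val]
    rw [hm' a b c habc]
    rcases Nat.eq_zero_or_pos b with rfl | hb <;> rcases Nat.eq_zero_or_pos c with rfl | hc
    · obtain rfl : a = 4 := by omega
      simp only [moments, ← ht]
      ring
    · obtain rfl : c = 4 - a := by omega
      have ha : a < 4 := by omega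
      interval_cases a <;> simp only [moments]
      · rw [b0]; ring
      · rw [b1]; ring
      · rw [b2]; ring
      · rw [← hβ]; ring
    · obtain rfl : b = 4 - a := by omega
      have ha : a < 4 := by omega
      interval_cases a <;> simp only [moments]
      · rw [a0]; ring
      · rw [a1]; ring
      · rw [a2]; ring
      · rw [← hα]; ring
    · rw [apply_mixed_monomial h a b c habc hb hc]
      have ha : a < 3 := by omega
      interval_cases a <;> simp [moments]

end

end PlaneQuartic

namespace PlaneQuartic

open MvPolynomial

variable {K : Type*} [Field K] {φ : MvPolynomial (Fin 3) K →ₗ[K] K}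

/-! ### Removing one evaluation -/

/-- If `Q` represents evaluation at `p` and `Q p ≠ 0`, then a suitable multiple of this evaluation
may be subtracted from `φ` so that `Q` becomes apolar; no other new apolar conics arise. -/
lemma apolar_sub_evalAt {Q : MvPolynomial (Fin 3) K} {p : Fin 3 → K} (hQ : Q.IsHomogeneous 2)
    (h : ∀ R : MvPolynomial (Fin 3) K, R.IsHomogeneous 2 → φ (Q * R) = eval p R)
    (h0 : eval p Q ≠ 0) :
    Apolar (φ - (eval p Q)⁻¹ • evalAt p) Q ∧
      ∀ P, Apolar (φ - (eval p Q)⁻¹ • evalAt p) P → ∃ k, Apolar φ (P - C k * Q) := by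
  refine ⟨⟨hQ, fun R hR => ?_⟩, fun P hP => ⟨(eval p Q)⁻¹ * eval p P, hP.1.sub (hQ.C_mul _),
    fun R hR => ?_⟩⟩
  · simp [h R hR, h0]
  · have := hP.2 R hR
    simp only [LinearMap.sub_apply, LinearMap.smul_apply, evalAt_apply, eval_mul, smul_eq_mul]
      at this
    rw [sub_mul, map_sub, mul_assoc, C_mul', map_smul, h R hR, smul_eq_mul]
    linear_combination this

/-- Uniqueness of apolar conics is preserved by coordinate changes. -/
lemma apolar_unique_pull {M : Matrix (Fin 3) (Fin 3) K} (hM : M.det ≠ 0)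
    {Q : MvPolynomial (Fin 3) K} (h : ∀ P, Apolar φ P → ∃ k, P = C k * subst M Q) :
    ∀ P, Apolar (pull φ M) P → ∃ k, P = C k * Q := by
  intro P hP
  obtain ⟨k, hk⟩ := h _ ((apolar_pull hM).1 hP)
  refine ⟨k, ?_⟩
  rw [← subst_inv_subst hM P, hk, map_mul, subst_inv_subst hM, algHom_C, algebraMap_eq]

section AlgClosed

variable [IsAlgClosed K] [CharZero K]

/-- A quartic with a unique apolar conic, which is nonsingular, is a sum of five fourth powers. -/
lemma IsSmooth.hasDecomp_five {q : MvPolynomial (Fin 3) K} (hs : IsSmooth q) (hq : Apolar φ q)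
    (hall : ∀ Q, Apolar φ Q → ∃ k, Q = C k * q) : HasDecomp φ 5 := by
  obtain ⟨M, hM, rfl⟩ := hs
  exact HasDecomp.of_pull hM (hasDecomp_five_of_standard_conic ((apolar_pull hM).2 hq)
    (apolar_unique_pull hM hall))

omit [IsAlgClosed K] [CharZero K] in
lemma X_mul_X_self_ne (k : K) (i j l : Fin 3) (hj : i ≠ j) :
    (X i * X i : MvPolynomial (Fin 3) K) ≠ C k * (X j * X l) := by
  intro h
  have := congrArg (eval (Pi.single i 1)) h
  simp [hj.symm] at this

/-- A quartic with a unique apolar conic, which is not a double line, is a sum of six fourth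
powers: if it is a pair of lines, then neither of the two binary quartics can be exceptional, since
in that case a double line would be apolar too. -/
lemma hasDecomp_six_of_unique_conic {Q : MvPolynomial (Fin 3) K} (hQ : Apolar φ Q)
    (hall : ∀ P, Apolar φ P → ∃ k, P = C k * Q)
    (hne : ∀ (k : K) (w : Fin 3 → K), Q ≠ C k * (lin w * lin w)) : HasDecomp φ 6 := by
  rcases lin_mul_lin_or_isSmooth hQ.1 with ⟨u, v, rfl⟩ | hs
  · rcases lin_mul_lin_eq_sq_or_exists_matrix u v with ⟨k, w, h⟩ | ⟨M, hM, h⟩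
    · exact absurd h (hne k w)
    · rw [h] at hQ hall
      have hQ' := (apolar_pull hM).2 hQ
      have hall' := apolar_unique_pull hM hall
      have eqv {F G : MvPolynomial (Fin 3) K} (hG : pull φ M G = 0) (hF : F = G) :
          pull φ M F = 0 := by
        rw [hF, hG]
      have mixed (a b c : ℕ) (habc : a + b + c = 4) (hb : 0 < b) (hc : 0 < c)
          {F : MvPolynomial (Fin 3) K} (hF : F = X 0 ^ a * X 1 ^ b * X 2 ^ c) :
          pull φ M F = 0 := by
        rw [hF, apply_mixed_monomial hQ' a b c habc hb hc]
      refine HasDecomp.of_pull hM (hasDecomp_six_of_line_pair hQ' ?_ ?_)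
      · intro h0 h1 h2
        exfalso
        have hap : Apolar (pull φ M) (X 1 * X 1) :=
          apolar_of_monomials (isHomogeneous_X_mul_X 1 1) (eqv h2 (by ring))
            (eqv h1 (by ring)) (mixed 1 2 1 rfl (by simp) (by simp) (by ring))
            (eqv h0 (by ring)) (mixed 0 3 1 rfl (by simp) (by simp) (by ring))
            (mixed 0 2 2 rfl (by simp) (by simp) (by ring))
        obtain ⟨k, hk⟩ := hall' _ hap
        exact X_mul_X_self_ne k 1 2 1 (by decide) (hk.trans (by ring))
      · intro h0 h1 h2
        exfalso
        have hap : Apolar (pull φ M) (X 2 * X 2) :=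
          apolar_of_monomials (isHomogeneous_X_mul_X 2 2) (eqv h2 (by ring))
            (mixed 1 1 2 rfl (by simp) (by simp) (by ring)) (eqv h1 (by ring))
            (mixed 0 2 2 rfl (by simp) (by simp) (by ring))
            (mixed 0 1 3 rfl (by simp) (by simp) (by ring)) (eqv h0 (by ring))
        obtain ⟨k, hk⟩ := hall' _ hap
        exact X_mul_X_self_ne k 2 1 2 (by decide) hk
  · exact (hs.hasDecomp_five hQ hall).mono (by norm_num)

/-- If the apolar conics form a pencil containing a nonsingular conic `q`, add the evaluation at a
point of `q` outside the base locus: then `q` becomes the only apolar conic. -/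
lemma hasDecomp_six_of_pencil {q Q : MvPolynomial (Fin 3) K} (hs : IsSmooth q) (hq : Apolar φ q)
    (hQ : Apolar φ Q) (hne : ∀ k, Q ≠ C k * q)
    (hall : ∀ P, Apolar φ P → ∃ k l, P = C k * q + C l * Q) : HasDecomp φ 6 := by
  obtain ⟨p, hpq, hpQ⟩ := hs.exists_eval_ne_zero hQ.1 hne
  refine HasDecomp.of_sub_evalAt (-1) p (hs.hasDecomp_five ⟨hq.1, fun R hR => ?_⟩ fun P hP => ?_)
  · simp [hq.2 R hR, hpq]
  · have hP' (R : MvPolynomial (Fin 3) K) (hR : R.IsHomogeneous 2) :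
        φ (P * R) + eval p P * eval p R = 0 := by
      simpa using hP.2 R hR
    have hpP : eval p P = 0 := by
      have := hP' Q hQ.1
      rw [mul_comm P, hQ.2 P hP.1, zero_add] at this
      exact (mul_eq_zero.1 this).resolve_right hpQ
    obtain ⟨k, l, hkl⟩ := hall P ⟨hP.1, fun R hR => by simpa [hpP] using hP' R hR⟩
    refine ⟨k, ?_⟩
    have hl : l = 0 := by
      rw [hkl] at hpP
      simpa [hpq, hpQ] using hpP
    rw [hkl, hl, C_0, zero_mul, add_zero]

end AlgClosed

end PlaneQuartic

namespace PlaneQuartic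

open MvPolynomial

variable {K : Type*} [Field K] {φ : MvPolynomial (Fin 3) K →ₗ[K] K}

/-! ### Removing the evaluation at a point of a double line -/

/-- The coefficients of the conic `x₀ (βX₀X₁ + γX₁²) + x₁ X₀X₂ + x₂ X₁X₂`. -/
def tangentCoeffs (β γ : K) (x : Fin 3 → K) : Fin 6 → K :=
  ![0, x 0 * β, x 1, x 0 * γ, x 2, 0]

lemma X_two_sq_eq_conic : (X 2 * X 2 : MvPolynomial (Fin 3) K) = conic ![0, 0, 0, 0, 0, 1] := by
  simp [conic]

section Tangent

variable {ε β γ : K}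
  (hε : ∀ R : MvPolynomial (Fin 3) K, R.IsHomogeneous 2 →
    φ (X 2 * X 2 * R) = ε * eval ![0, 0, 1] R)
  (h0 : β * φ (X 2 * (X 0 * X 0 * X 1)) + γ * φ (X 2 * (X 0 * X 1 * X 1)) = 0)
  (h1 : β * φ (X 2 * (X 0 * X 1 * X 1)) + γ * φ (X 2 * (X 1 * X 1 * X 1)) = 0)

include hε h0 in
lemma tangent_apply_zero (x : Fin 3 → K) :
    φ (conic (tangentCoeffs β γ x) * (X 0 * X 2)) = 0 := by
  have e1 := hε _ (isHomogeneous_X_mul_X 0 0)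
  have e2 := hε _ (isHomogeneous_X_mul_X 0 1)
  simp at e1 e2
  have : conic (tangentCoeffs β γ x) * (X 0 * X 2)
      = C (x 0 * β) * (X 2 * (X 0 * X 0 * X 1)) + C (x 0 * γ) * (X 2 * (X 0 * X 1 * X 1))
        + C (x 1) * (X 2 * X 2 * (X 0 * X 0)) + C (x 2) * (X 2 * X 2 * (X 0 * X 1)) := by
    simp [conic, tangentCoeffs]
    ring
  rw [this]
  simp only [map_add, C_mul', map_smul, smul_eq_mul, e1, e2]
  linear_combination x 0 * h0

include hε h1 in
lemma tangent_apply_one (x : Fin 3 → K) :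
    φ (conic (tangentCoeffs β γ x) * (X 1 * X 2)) = 0 := by
  have e1 := hε _ (isHomogeneous_X_mul_X 0 1)
  have e2 := hε _ (isHomogeneous_X_mul_X 1 1)
  simp at e1 e2
  have : conic (tangentCoeffs β γ x) * (X 1 * X 2)
      = C (x 0 * β) * (X 2 * (X 0 * X 1 * X 1)) + C (x 0 * γ) * (X 2 * (X 1 * X 1 * X 1))
        + C (x 1) * (X 2 * X 2 * (X 0 * X 1)) + C (x 2) * (X 2 * X 2 * (X 1 * X 1)) := by
    simp [conic, tangentCoeffs]
    ring
  rw [this]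
  simp only [map_add, C_mul', map_smul, smul_eq_mul, e1, e2]
  linear_combination x 0 * h1

include hε in
lemma tangent_apply_two (x : Fin 3 → K) :
    φ (conic (tangentCoeffs β γ x) * (X 2 * X 2)) = 0 := by
  rw [mul_comm, hε _ (conic_isHomogeneous _), eval_conic]
  simp [tangentCoeffs]

include hε h0 h1 in
/-- For a general point `p` on the line `X₂ = 0`, evaluation at `p` is represented by a conic of
the family `tangentCoeffs β γ`. -/
lemma exists_tangent_conic [Infinite K]
    (hall : ∀ Q, Apolar φ Q → ∃ k, Q = C k * (X 2 * X 2)) (hβγ : β ≠ 0 ∨ γ ≠ 0) :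
    ∃ (s : K) (x : Fin 3 → K), x 0 ≠ 0 ∧ x 1 ≠ 0 ∧
      eval ![1, s, 0] (conic (tangentCoeffs β γ x)) ≠ 0 ∧
      ∀ R : MvPolynomial (Fin 3) K, R.IsHomogeneous 2 →
        φ (conic (tangentCoeffs β γ x) * R) = eval ![1, s, 0] R := by
  have tc_add (x y : Fin 3 → K) :
      tangentCoeffs β γ (x + y) = tangentCoeffs β γ x + tangentCoeffs β γ y := by
    ext i; fin_cases i <;> simp [tangentCoeffs, add_mul]
  have tc_smul (k : K) (x : Fin 3 → K) :
      tangentCoeffs β γ (k • x) = k • tangentCoeffs β γ x := by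
    ext i; fin_cases i <;> simp [tangentCoeffs, mul_assoc]
  let N : (Fin 3 → K) →ₗ[K] (Fin 3 → K) :=
    { toFun := fun x => ![φ (conic (tangentCoeffs β γ x) * (X 0 * X 0)),
        φ (conic (tangentCoeffs β γ x) * (X 0 * X 1)),
        φ (conic (tangentCoeffs β γ x) * (X 1 * X 1))]
      map_add' := fun x y => by
        simp [tc_add, conic_add, add_mul]
      map_smul' := fun k x => by
        simp only [tc_smul, conic_smul, C_mul', smul_mul_assoc, map_smul, RingHom.id_apply,
          Matrix.smul_cons, Matrix.smul_empty] }
  have hN : Function.Injective N := by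
    rw [← LinearMap.ker_eq_bot, LinearMap.ker_eq_bot']
    intro x hx
    have hap : Apolar φ (conic (tangentCoeffs β γ x)) :=
      apolar_of_monomials (conic_isHomogeneous _) (congrFun hx 0) (congrFun hx 1)
        (tangent_apply_zero hε h0 x) (congrFun hx 2) (tangent_apply_one hε h1 x)
        (tangent_apply_two hε x)
    obtain ⟨k, hk⟩ := hall _ hap
    rw [X_two_sq_eq_conic, ← conic_smul] at hk
    have hk := conic_injective hk
    have k1 : x 0 * β = 0 := by simpa [tangentCoeffs] using congrFun hk 1
    have k2 : x 1 = 0 := by simpa [tangentCoeffs] using congrFun hk 2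
    have k3 : x 0 * γ = 0 := by simpa [tangentCoeffs] using congrFun hk 3
    have k4 : x 2 = 0 := by simpa [tangentCoeffs] using congrFun hk 4
    have k0 : x 0 = 0 := by
      rcases hβγ with h | h
      · exact (mul_eq_zero.1 k1).resolve_right h
      · exact (mul_eq_zero.1 k3).resolve_right h
    ext i
    fin_cases i <;> simp [k0, k2, k4]
  let E := LinearEquiv.ofInjectiveEndo N hN
  -- The coordinates of `E.symm ![1, s, s²]` are nonzero polynomials in `s`.
  have hsymm (s : K) (i : Fin 3) : E.symm ![1, s, s ^ 2] i
      = E.symm ![0, 0, 1] i * s ^ 2 + E.symm ![0, 1, 0] i * s + E.symm ![1, 0, 0] i := by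
    have : (![1, s, s ^ 2] : Fin 3 → K)
        = s ^ 2 • ![0, 0, 1] + s • ![0, 1, 0] + ![1, 0, 0] := by
      ext j; fin_cases j <;> simp
    rw [this, map_add, map_add, map_smul, map_smul]
    simp [mul_comm]
  have hpoly (i : Fin 3) : E.symm ![0, 0, 1] i ≠ 0 ∨ E.symm ![0, 1, 0] i ≠ 0 ∨
      E.symm ![1, 0, 0] i ≠ 0 := by
    by_contra! hcon
    obtain ⟨k2, k1, k0⟩ := hcon
    have : (E (Pi.single i 1)) = E (Pi.single i 1) 2 • ![0, 0, 1] + E (Pi.single i 1) 1 • ![0, 1, 0]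
        + E (Pi.single i 1) 0 • ![1, 0, 0] := by
      ext j; fin_cases j <;> simp
    have := congrFun (congrArg E.symm this) i
    rw [LinearEquiv.symm_apply_apply, map_add, map_add, map_smul, map_smul, map_smul] at this
    simp [k0, k1, k2] at this
  obtain ⟨s, hs⟩ := exists_eval_ne_zero (mul_ne_zero (mul_ne_zero (quadratic_ne_zero (hpoly 0))
    (quadratic_ne_zero (hpoly 1))) (quadratic_ne_zero (a := γ) (b := β) (c := 0) (by tauto)))
  simp only [Polynomial.eval_mul, Polynomial.eval_add, Polynomial.eval_C, Polynomial.eval_pow,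
    Polynomial.eval_X, mul_ne_zero_iff, ← hsymm] at hs
  obtain ⟨⟨hx0, hx1⟩, hT⟩ := hs
  refine ⟨s, E.symm ![1, s, s ^ 2], hx0, hx1, ?_, fun R hR => ?_⟩
  · rw [eval_conic]
    simp only [tangentCoeffs, Matrix.cons_val_zero, Matrix.cons_val_one, Matrix.cons_val]
    intro h
    refine mul_ne_zero hx0 hT ?_
    linear_combination h
  · have hE : N (E.symm ![1, s, s ^ 2]) = ![1, s, s ^ 2] := E.apply_symm_apply _
    have e0 := congrFun hE 0
    have e1 := congrFun hE 1
    have e2 := congrFun hE 2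
    refine eq_on_conics (φ := mulBy φ _) (χ := evalAt ![1, s, 0]) (e0.trans ?_) (e1.trans ?_)
      ((tangent_apply_zero hε h0 _).trans ?_) (e2.trans ?_)
      ((tangent_apply_one hε h1 _).trans ?_) ((tangent_apply_two hε _).trans ?_) hR <;>
    simp [pow_two]

end Tangent

section AlgClosed

variable [IsAlgClosed K] [CharZero K]

/-- Let the square of the line `X₂ = 0` act as a multiple of evaluation at `(0, 0, 1)`, and let
there be no other apolar conic. Removing the evaluation at a general point of the line gives a
quartic with a unique apolar conic (if `ε ≠ 0`) or a pencil of apolar conics that contains a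
nonsingular one (if `ε = 0`). -/
lemma hasDecomp_seven_of_tangent {ε β γ : K}
    (hε : ∀ R : MvPolynomial (Fin 3) K, R.IsHomogeneous 2 →
      φ (X 2 * X 2 * R) = ε * eval ![0, 0, 1] R)
    (hall : ∀ Q, Apolar φ Q → ∃ k, Q = C k * (X 2 * X 2)) (hβγ : β ≠ 0 ∨ γ ≠ 0)
    (h0 : β * φ (X 2 * (X 0 * X 0 * X 1)) + γ * φ (X 2 * (X 0 * X 1 * X 1)) = 0)
    (h1 : β * φ (X 2 * (X 0 * X 1 * X 1)) + γ * φ (X 2 * (X 1 * X 1 * X 1)) = 0) :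
    HasDecomp φ 7 := by
  obtain ⟨s, x, hx0, hx1, hQp, hQ⟩ := exists_tangent_conic hε h0 h1 hall hβγ
  set Q := conic (tangentCoeffs β γ x) with hQdef
  obtain ⟨hap, hnew⟩ := apolar_sub_evalAt (Q := Q) (conic_isHomogeneous _) hQ hQp
  refine HasDecomp.of_sub_evalAt (eval ![1, s, 0] Q)⁻¹ ![1, s, 0] (r := 6) ?_
  by_cases he : ε = 0
  · have hX : Apolar (φ - (eval ![1, s, 0] Q)⁻¹ • evalAt ![1, s, 0]) (X 2 * X 2) :=
      ⟨isHomogeneous_X_mul_X 2 2, fun R hR => by simp [hε R hR, he]⟩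
    -- The discriminant of `Q + l X₂²` as a function of `l`.
    obtain ⟨l, hl⟩ : ∃ l : K, x 0 * β * x 1 * x 2 - x 0 * γ * x 1 ^ 2 - l * (x 0 * β) ^ 2 ≠ 0 := by
      by_cases hβ : β = 0
      · refine ⟨0, ?_⟩
        have hγ : γ ≠ 0 := hβγ.resolve_left (not_not.2 hβ)
        simp [hβ, hγ, hx0, hx1]
      · refine ⟨(x 0 * β * x 1 * x 2 - x 0 * γ * x 1 ^ 2 - 1) / (x 0 * β) ^ 2, ?_⟩
        rw [div_mul_cancel₀ _ (pow_ne_zero 2 (mul_ne_zero hx0 hβ)), sub_sub_cancel]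
        exact one_ne_zero
    have hsm : IsSmooth (Q + C l * (X 2 * X 2)) := by
      rw [hQdef, X_two_sq_eq_conic, ← conic_smul, ← conic_add]
      refine isSmooth_of_det_ne_zero ?_
      simpa [tangentCoeffs] using hl
    refine hasDecomp_six_of_pencil hsm (hap.add (hX.C_mul l)) hX (fun k hk => ?_) fun P hP => ?_
    · rw [hQdef, X_two_sq_eq_conic, ← conic_smul, ← conic_add, ← conic_smul] at hk
      have hk := conic_injective hk
      have hk0 : k = 0 := by
        have := congrFun hk 2
        simpa [tangentCoeffs, hx1] using this
      have := congrFun hk 5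
      simp [hk0] at this
    · obtain ⟨k, hk⟩ := hnew P hP
      obtain ⟨k', hk'⟩ := hall _ hk
      refine ⟨k, k' - k * l, ?_⟩
      rw [C_sub, C_mul]
      linear_combination hk'
  · refine hasDecomp_six_of_unique_conic hap (fun P hP => ?_) fun k w hkw => ?_
    · obtain ⟨k, hk⟩ := hnew P hP
      obtain ⟨k', hk'⟩ := hall _ hk
      refine ⟨k, ?_⟩
      have := hk.2 _ (isHomogeneous_X_mul_X 2 2)
      rw [hk', mul_assoc, C_mul', map_smul, hε _ (isHomogeneous_X_mul_X 2 2)] at this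
      have hk0 : k' = 0 := by simpa [he] using this
      rw [hk0, C_0, zero_mul] at hk'
      exact sub_eq_zero.1 hk'
    · rw [hQdef, lin_mul_lin_eq_conic, ← conic_smul] at hkw
      have hkw := conic_injective hkw
      have e0 : k * (w 0 * w 0) = 0 := by simpa [tangentCoeffs] using (congrFun hkw 0).symm
      have e2 : x 1 = k * (w 0 * w 2 + w 2 * w 0) := by simpa [tangentCoeffs] using congrFun hkw 2
      apply hx1
      rcases mul_eq_zero.1 e0 with h | h
      · rw [e2, h, zero_mul]
      · rw [e2, mul_self_eq_zero.1 h]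
        ring

/-- If the square of the line `X₂ = 0` acts as a multiple of evaluation at `(0, 0, 1)` and there is
no other apolar conic, then seven summands suffice. The condition on `R ↦ φ (X₂ R)` in
`hasDecomp_seven_of_tangent` is attained by a change of the coordinates `X₀, X₁`, because the
Hessian of a binary cubic form has a root. -/
lemma hasDecomp_seven_of_double_line {ε : K}
    (hε : ∀ R : MvPolynomial (Fin 3) K, R.IsHomogeneous 2 →
      φ (X 2 * X 2 * R) = ε * eval ![0, 0, 1] R)
    (hall : ∀ Q, Apolar φ Q → ∃ k, Q = C k * (X 2 * X 2)) : HasDecomp φ 7 := by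
  -- It suffices to find coordinates in which the Hessian has the root `(0, 1)`.
  have key {χ : MvPolynomial (Fin 3) K →ₗ[K] K} (hεχ : ∀ R : MvPolynomial (Fin 3) K,
      R.IsHomogeneous 2 → χ (X 2 * X 2 * R) = ε * eval ![0, 0, 1] R)
      (hallχ : ∀ Q, Apolar χ Q → ∃ k, Q = C k * (X 2 * X 2))
      (hχ : χ (X 2 * (X 0 * X 0 * X 1)) * χ (X 2 * (X 1 * X 1 * X 1))
        = χ (X 2 * (X 0 * X 1 * X 1)) ^ 2) : HasDecomp χ 7 := by
    by_cases h : χ (X 2 * (X 0 * X 1 * X 1)) = 0 ∧ χ (X 2 * (X 0 * X 0 * X 1)) = 0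
    · refine hasDecomp_seven_of_tangent (β := 1) (γ := 0) hεχ hallχ (by simp) ?_ ?_
      · rw [h.1, h.2]; ring
      · rw [h.1]; ring
    · refine hasDecomp_seven_of_tangent (β := χ (X 2 * (X 0 * X 1 * X 1)))
        (γ := -χ (X 2 * (X 0 * X 0 * X 1))) hεχ hallχ ?_ ?_ ?_
      · rw [neg_ne_zero]; tauto
      · ring
      · linear_combination -hχ
  have hpull {M : Matrix (Fin 3) (Fin 3) K} (hM : M.det ≠ 0) (h2 : lin (M 2) = X 2)
      (hp : M.mulVec ![0, 0, 1] = ![0, 0, 1]) (hχ : pull φ M (X 2 * (X 0 * X 0 * X 1))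
        * pull φ M (X 2 * (X 1 * X 1 * X 1)) = pull φ M (X 2 * (X 0 * X 1 * X 1)) ^ 2) :
      HasDecomp φ 7 := by
    refine HasDecomp.of_pull hM (key (fun R hR => ?_) (apolar_unique_pull hM ?_) hχ)
    · rw [pull_apply, map_mul, subst_X_mul_X, h2, hε _ (subst_isHomogeneous M hR), eval_subst, hp]
    · intro P hP
      rw [subst_X_mul_X, h2]
      exact hall P hP
  set g₀ := φ (X 2 * (X 0 * X 0 * X 0)) with hg₀
  set g₁ := φ (X 2 * (X 0 * X 0 * X 1)) with hg₁
  set g₂ := φ (X 2 * (X 0 * X 1 * X 1)) with hg₂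
  set g₃ := φ (X 2 * (X 1 * X 1 * X 1)) with hg₃
  by_cases h : g₀ * g₂ - g₁ ^ 2 = 0
  · refine hpull (M := !![0, 1, 0; 1, 0, 0; 0, 0, 1]) ?_ ?_ ?_ ?_
    · simp [Matrix.det_fin_three]
    · simp [lin_eq]
    · ext i; fin_cases i <;> simp [Matrix.mulVec, dotProduct, Fin.sum_univ_three]
    · simp only [pull_apply, map_mul, subst_X]
      have e0 : lin (!![0, 1, 0; 1, 0, 0; 0, 0, (1 : K)] 0) = X 1 := by simp [lin_eq]
      have e1 : lin (!![0, 1, 0; 1, 0, 0; 0, 0, (1 : K)] 1) = X 0 := by simp [lin_eq]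
      have e2 : lin (!![0, 1, 0; 1, 0, 0; 0, 0, (1 : K)] 2) = X 2 := by simp [lin_eq]
      rw [e0, e1, e2, show (X 1 * X 1 * X 0 : MvPolynomial (Fin 3) K) = X 0 * X 1 * X 1 by ring,
        show (X 1 * X 0 * X 0 : MvPolynomial (Fin 3) K) = X 0 * X 0 * X 1 by ring]
      linear_combination h
  · obtain ⟨d, hd⟩ := IsAlgClosed.exists_eq_mul_self
      (discrim (g₀ * g₂ - g₁ ^ 2) (g₀ * g₃ - g₁ * g₂) (g₁ * g₃ - g₂ ^ 2))
    obtain ⟨s, hs⟩ := exists_quadratic_eq_zero h ⟨d, hd⟩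
    refine hpull (M := !![1, 0, 0; s, 1, 0; 0, 0, 1]) ?_ ?_ ?_ ?_
    · simp [Matrix.det_fin_three]
    · simp [lin_eq]
    · ext i; fin_cases i <;> simp [Matrix.mulVec, dotProduct, Fin.sum_univ_three]
    · simp only [pull_apply, map_mul, subst_X]
      have e0 : lin (!![1, 0, 0; s, 1, 0; 0, 0, (1 : K)] 0) = X 0 := by simp [lin_eq]
      have e1 : lin (!![1, 0, 0; s, 1, 0; 0, 0, (1 : K)] 1) = C s * X 0 + X 1 := by simp [lin_eq]
      have e2 : lin (!![1, 0, 0; s, 1, 0; 0, 0, (1 : K)] 2) = X 2 := by simp [lin_eq]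
      have f1 : (X 2 * (X 0 * X 0 * (C s * X 0 + X 1)) : MvPolynomial (Fin 3) K)
          = C s * (X 2 * (X 0 * X 0 * X 0)) + X 2 * (X 0 * X 0 * X 1) := by ring
      have f2 : (X 2 * (X 0 * (C s * X 0 + X 1) * (C s * X 0 + X 1)) : MvPolynomial (Fin 3) K)
          = C (s ^ 2) * (X 2 * (X 0 * X 0 * X 0)) + C (2 * s) * (X 2 * (X 0 * X 0 * X 1))
            + X 2 * (X 0 * X 1 * X 1) := by
        rw [C_pow, C_mul, map_ofNat]; ring
      have f3 : (X 2 * ((C s * X 0 + X 1) * (C s * X 0 + X 1) * (C s * X 0 + X 1)) :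
          MvPolynomial (Fin 3) K)
          = C (s ^ 3) * (X 2 * (X 0 * X 0 * X 0)) + C (3 * s ^ 2) * (X 2 * (X 0 * X 0 * X 1))
            + C (3 * s) * (X 2 * (X 0 * X 1 * X 1)) + X 2 * (X 1 * X 1 * X 1) := by
        rw [C_pow, C_mul, C_mul, C_pow, map_ofNat]; ring
      rw [e0, e1, e2, f1, f2, f3]
      simp only [map_add, C_mul', map_smul, smul_eq_mul, ← hg₀, ← hg₁, ← hg₂, ← hg₃]
      linear_combination hs

omit [IsAlgClosed K] [CharZero K] in
/-- Coordinates in which the linear form `t` is `X₂` and the point `p` is a multiple of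
`(0, 0, 1)`. -/
lemma exists_matrix_of_line_and_point (t p : Fin 3 → K)
    (h : t 0 * p 0 + t 1 * p 1 + t 2 * p 2 ≠ 0) :
    ∃ M : Matrix (Fin 3) (Fin 3) K, M.det ≠ 0 ∧ M 2 = t ∧
      M.mulVec p = ![0, 0, t 0 * p 0 + t 1 * p 1 + t 2 * p 2] := by
  have hmul (u v : Fin 3 → K) (hu : u 0 * p 0 + u 1 * p 1 + u 2 * p 2 = 0)
      (hv : v 0 * p 0 + v 1 * p 1 + v 2 * p 2 = 0) : (Matrix.of ![u, v, t]).mulVec p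
        = ![0, 0, t 0 * p 0 + t 1 * p 1 + t 2 * p 2] := by
    ext i
    fin_cases i <;> simp [Matrix.mulVec, dotProduct, Fin.sum_univ_three, hu, hv]
  have hdet (u v : Fin 3 → K) (k : K) (hk : k ≠ 0) (huv : (Matrix.of ![u, v, t]).det
      = k * (t 0 * p 0 + t 1 * p 1 + t 2 * p 2)) : (Matrix.of ![u, v, t]).det ≠ 0 := by
    rw [huv]
    exact mul_ne_zero hk h
  by_cases h2 : p 2 = 0
  · by_cases h1 : p 1 = 0
    · have h0 : p 0 ≠ 0 := by
        rintro h0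
        simp [h0, h1, h2] at h
      exact ⟨Matrix.of ![![-p 1, p 0, 0], ![-p 2, 0, p 0], t],
        hdet _ _ (p 0) h0 (by simp [Matrix.det_fin_three]; ring), rfl,
        hmul _ _ (by simp; ring) (by simp; ring)⟩
    · exact ⟨Matrix.of ![![-p 1, p 0, 0], ![0, -p 2, p 1], t],
        hdet _ _ (p 1) h1 (by simp [Matrix.det_fin_three]; ring), rfl,
        hmul _ _ (by simp; ring) (by simp; ring)⟩
  · exact ⟨Matrix.of ![![p 2, 0, -p 0], ![0, p 2, -p 1], t],
      hdet _ _ (p 2) h2 (by simp [Matrix.det_fin_three]; ring), rfl,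
      hmul _ _ (by simp; ring) (by simp; ring)⟩

omit [IsAlgClosed K] [CharZero K] in
lemma eval_smul_of_isHomogeneous {F : MvPolynomial (Fin 3) K} {n : ℕ} (hF : F.IsHomogeneous n)
    (k : K) (p : Fin 3 → K) : eval (k • p) F = k ^ n * eval p F := by
  refine form_induction (p := fun F => eval (k • p) F = k ^ n * eval p F) ?_ (by simp) ?_ hF
  · rintro l a b c rfl
    simp
    ring
  · intro F G hF hG
    rw [map_add, map_add, hF, hG]
    ring

/-- The coordinate-free form of `hasDecomp_seven_of_double_line`. -/
lemma hasDecomp_seven_of_line_and_point {ε : K} {t p : Fin 3 → K} (htp : eval p (lin t) ≠ 0)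
    (hε : ∀ R : MvPolynomial (Fin 3) K, R.IsHomogeneous 2 →
      φ (lin t * lin t * R) = ε * eval p R)
    (hall : ∀ Q, Apolar φ Q → ∃ k, Q = C k * (lin t * lin t)) : HasDecomp φ 7 := by
  rw [eval_lin] at htp
  obtain ⟨M, hM, rfl, hMp⟩ := exists_matrix_of_line_and_point t p htp
  set k := M 2 0 * p 0 + M 2 1 * p 1 + M 2 2 * p 2
  rw [← subst_X_mul_X] at hε hall
  refine HasDecomp.of_pull hM (hasDecomp_seven_of_double_line (ε := ε * k ^ 2) (fun R hR => ?_)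
    (apolar_unique_pull hM hall))
  rw [pull_apply, map_mul, hε _ (subst_isHomogeneous M hR), eval_subst, hMp,
    show (![0, 0, k] : Fin 3 → K) = k • ![0, 0, 1] by simp, eval_smul_of_isHomogeneous hR]
  ring

/-! ### Quartics without apolar conics -/

omit [IsAlgClosed K] in
/-- If no conic is apolar to `φ`, then evaluation at any point `p` is represented by a conic
`Q_p`. The trace of the identity of the space of conics equals `φ Ω` for the quartic form
`Ω : p ↦ Q_p p`, so that `Q_p p ≠ 0` for some `p`. -/
lemma exists_representing_conic (hφ : ∀ Q, Apolar φ Q → Q = 0) :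
    ∃ (p : Fin 3 → K) (Q : MvPolynomial (Fin 3) K), Q.IsHomogeneous 2 ∧ eval p Q ≠ 0 ∧
      ∀ R : MvPolynomial (Fin 3) K, R.IsHomogeneous 2 → φ (Q * R) = eval p R := by
  have hconic (d : Fin 6 → K) : conic d = ∑ j, C (d j) * conic (Pi.single j 1) := by
    simp [Fin.sum_univ_six, conic, Pi.single_apply]
  let A : (Fin 6 → K) →ₗ[K] (Fin 6 → K) :=
    { toFun := fun c j => φ (conic c * conic (Pi.single j 1))
      map_add' := fun c d => by
        ext j
        simp [conic_add, add_mul]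
      map_smul' := fun k c => by
        ext j
        simp only [conic_smul, C_mul', smul_mul_assoc, map_smul, RingHom.id_apply, Pi.smul_apply] }
  have hA (c d : Fin 6 → K) : φ (conic c * conic d) = ∑ j, d j * A c j := by
    rw [hconic d, Finset.mul_sum, map_sum]
    refine Finset.sum_congr rfl fun j _ => ?_
    rw [mul_left_comm, C_mul', map_smul]
    rfl
  have hinj : Function.Injective A := by
    rw [← LinearMap.ker_eq_bot, LinearMap.ker_eq_bot']
    intro c hc
    refine conic_eq_zero (hφ _ ⟨conic_isHomogeneous c, fun R hR => ?_⟩)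
    obtain ⟨d, rfl⟩ := exists_conic hR
    simp [hA, hc]
  let E := LinearEquiv.ofInjectiveEndo A hinj
  have hE (j : Fin 6) (d : Fin 6 → K) : φ (conic (E.symm (Pi.single j 1)) * conic d) = d j := by
    have : A (E.symm (Pi.single j 1)) = Pi.single j 1 := E.apply_symm_apply _
    rw [hA, this]
    simp [Pi.single_apply]
  set Ω : MvPolynomial (Fin 3) K :=
    ∑ j : Fin 6, conic (E.symm (Pi.single j 1)) * conic (Pi.single j 1) with hΩ
  have hΩφ : φ Ω = 6 := by
    rw [hΩ, map_sum]
    simp [hE]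
  obtain ⟨p, hp⟩ : ∃ p, eval p Ω ≠ 0 := by
    by_contra! hcon
    have : Ω = 0 := MvPolynomial.funext fun p => by rw [hcon p, map_zero]
    rw [this, map_zero] at hΩφ
    norm_num at hΩφ
  refine ⟨p, ∑ j : Fin 6, C (eval p (conic (Pi.single j 1))) * conic (E.symm (Pi.single j 1)),
    ?_, ?_, fun R hR => ?_⟩
  · exact IsHomogeneous.sum _ _ _ fun j _ => (conic_isHomogeneous _).C_mul _
  · convert hp using 1
    simp [hΩ, mul_comm]
  · obtain ⟨d, rfl⟩ := exists_conic hR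
    rw [Finset.sum_mul, map_sum]
    simp_rw [mul_assoc, C_mul', map_smul, hE]
    conv_rhs => rw [hconic d]
    simp [mul_comm]

/-- A quartic without apolar conics is a sum of seven fourth powers. Removing the evaluation at a
point `p` with `Q_p p ≠ 0` makes `Q_p` the only apolar conic, which suffices unless `Q_p` is a double
line. -/
lemma hasDecomp_seven_of_no_apolar_conic (hφ : ∀ Q, Apolar φ Q → Q = 0) : HasDecomp φ 7 := by
  obtain ⟨p, Q, hQ, hQp, hrep⟩ := exists_representing_conic hφ
  by_cases hsq : ∃ (k : K) (w : Fin 3 → K), Q = C k * (lin w * lin w)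
  · obtain ⟨k, w, rfl⟩ := hsq
    rw [eval_mul, eval_C, eval_mul] at hQp
    have hk : k ≠ 0 := left_ne_zero_of_mul hQp
    refine hasDecomp_seven_of_line_and_point (ε := k⁻¹)
      (left_ne_zero_of_mul (right_ne_zero_of_mul hQp)) (fun R hR => ?_) fun P hP =>
        ⟨0, by rw [hφ P hP, C_0, zero_mul]⟩
    rw [← hrep R hR, mul_assoc (C k), C_mul', map_smul, smul_eq_mul, inv_mul_cancel_left₀ hk]
  · push Not at hsq
    obtain ⟨hap, hnew⟩ := apolar_sub_evalAt hQ hrep hQp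
    refine HasDecomp.of_sub_evalAt _ _ (hasDecomp_six_of_unique_conic hap (fun P hP => ?_) hsq)
    obtain ⟨k, hk⟩ := hnew P hP
    exact ⟨k, sub_eq_zero.1 (hφ _ hk)⟩

/-! ### The upper bound -/

omit [CharZero K] in
/-- Over an algebraically closed field, scalars can be absorbed into squares. -/
lemma exists_eq_lin_mul_self (k : K) (w : Fin 3 → K) :
    ∃ t, C k * (lin w * lin w) = lin t * lin t := by
  obtain ⟨l, rfl⟩ := IsAlgClosed.exists_eq_mul_self k
  exact ⟨l • w, by rw [lin_smul, C_mul]; ring⟩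

/-- Every functional on ternary quartic forms is a combination of seven evaluations. -/
theorem hasDecomp_seven (φ : MvPolynomial (Fin 3) K →ₗ[K] K) : HasDecomp φ 7 := by
  by_cases hpair : ∃ M : Matrix (Fin 3) (Fin 3) K, M.det ≠ 0 ∧ Apolar φ (subst M (X 1 * X 2))
  · obtain ⟨M, hM, h⟩ := hpair
    exact HasDecomp.of_pull hM (hasDecomp_seven_of_line_pair ((apolar_pull hM).2 h))
  have hsq (u v : Fin 3 → K) (h : Apolar φ (lin u * lin v)) :
      ∃ t, lin u * lin v = lin t * lin t := by
    rcases lin_mul_lin_eq_sq_or_exists_matrix u v with ⟨k, w, hk⟩ | ⟨M, hM, hk⟩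
    · obtain ⟨t, ht⟩ := exists_eq_lin_mul_self k w
      exact ⟨t, hk.trans ht⟩
    · exact absurd ⟨M, hM, hk ▸ h⟩ hpair
  have htwo (t s : Fin 3 → K) (ht : Apolar φ (lin t * lin t)) (hs : Apolar φ (lin s * lin s)) :
      lin s * lin s = 0 ∨ ∃ k : K, lin t * lin t = C k * (lin s * lin s) := by
    rcases squares_proportional_or_exists_matrix t s with h | h | ⟨M, hM, h⟩
    · exact Or.inl h
    · exact Or.inr h
    · exact absurd ⟨M, hM, h ▸ ht.sub hs⟩ hpair
  by_cases hsm : ∃ q, Apolar φ q ∧ IsSmooth q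
  · obtain ⟨q, hq, hs⟩ := hsm
    by_cases h1 : ∀ Q, Apolar φ Q → ∃ k, Q = C k * q
    · exact (hs.hasDecomp_five hq h1).mono (by norm_num)
    push Not at h1
    obtain ⟨Q, hQ, hne⟩ := h1
    refine (hasDecomp_six_of_pencil hs hq hQ hne fun P hP => ?_).mono (by norm_num)
    -- Two pencils containing `q` would give two different apolar double lines.
    obtain ⟨k, u, v, hk⟩ := hs.exists_add_eq_lin_mul_lin hQ.1
    obtain ⟨l, u', v', hl⟩ := hs.exists_add_eq_lin_mul_lin hP.1
    have hk' := hQ.add (hq.C_mul k)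
    have hl' := hP.add (hq.C_mul l)
    rw [hk] at hk'
    rw [hl] at hl'
    obtain ⟨s, hs⟩ := hsq u v hk'
    obtain ⟨t, ht⟩ := hsq u' v' hl'
    rw [hs] at hk hk'
    rw [ht] at hl hl'
    rcases htwo t s hl' hk' with h | ⟨m, h⟩
    · refine absurd ?_ (hne (-k))
      rw [C_neg]
      linear_combination hk + h
    · refine ⟨m * k - l, m, ?_⟩
      rw [C_sub, C_mul]
      linear_combination hl + h - C m * hk
  push Not at hsm
  have hall (Q : MvPolynomial (Fin 3) K) (hQ : Apolar φ Q) : ∃ t, Q = lin t * lin t := by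
    rcases lin_mul_lin_or_isSmooth hQ.1 with ⟨u, v, rfl⟩ | h
    · exact hsq u v hQ
    · exact absurd h (hsm Q hQ)
  by_cases hnone : ∀ Q, Apolar φ Q → Q = 0
  · exact hasDecomp_seven_of_no_apolar_conic hnone
  push Not at hnone
  obtain ⟨Q, hQ, hQ0⟩ := hnone
  obtain ⟨s, rfl⟩ := hall Q hQ
  have hs0 : s ≠ 0 := by
    rintro rfl
    simp at hQ0
  obtain ⟨i, hi⟩ := Function.ne_iff.1 hs0
  refine hasDecomp_seven_of_line_and_point (ε := 0) (t := s) (p := Pi.single i 1) ?_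
    (fun R hR => by rw [hQ.2 R hR, zero_mul]) fun P hP => ?_
  · rw [eval_lin]
    fin_cases i <;> simpa using hi
  · obtain ⟨t, rfl⟩ := hall P hP
    exact (htwo t s hP hQ).resolve_left hQ0

end AlgClosed

end PlaneQuartic

namespace PlaneQuartic

open MvPolynomial

variable {K : Type*} [Field K]

/-! ### Quartic forms as functionals -/

/-- The exponent vector `(a, b, c)`. -/
noncomputable def expo (a b c : ℕ) : Fin 3 →₀ ℕ := Finsupp.equivFunOnFinite.symm ![a, b, c]

lemma monomial_expo (a b c : ℕ) :
    (X 0 ^ a * X 1 ^ b * X 2 ^ c : MvPolynomial (Fin 3) K) = monomial (expo a b c) 1 := by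
  rw [monomial_eq, Finsupp.prod_fintype _ _ (by simp), Fin.prod_univ_three]
  simp [expo]

lemma multinomial_expo (a b c : ℕ) :
    (expo a b c).multinomial
      = (a + b + c).factorial / (a.factorial * b.factorial * c.factorial) := by
  rw [Finsupp.multinomial_eq_of_support_subset (Finset.subset_univ _), ← Nat.multinomial_univ_three]
  rfl

lemma degree_expo (a b c : ℕ) : (expo a b c).sum (fun _ m => m) = a + b + c := by
  simp [Finsupp.sum_fintype, Fin.sum_univ_three, expo]

lemma prod_expo (p : Fin 3 → K) (a b c : ℕ) :
    (expo a b c).prod (fun i m => p i ^ m) = p 0 ^ a * p 1 ^ b * p 2 ^ c := by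
  simp [Finsupp.prod_fintype, Fin.prod_univ_three, expo]

lemma expo_injective {a b c a' b' c' : ℕ} :
    expo a b c = expo a' b' c' ↔ a = a' ∧ b = b' ∧ c = c' := by
  rw [expo, expo, Equiv.apply_eq_iff_eq]
  simp

/-- The functional attached to a quartic form, normalized so that the fourth power of the linear
form `p₀X₀ + p₁X₁ + p₂X₂` gives evaluation at `p` (on quartic forms). -/
noncomputable def dual : MvPolynomial (Fin 3) K →ₗ[K] MvPolynomial (Fin 3) K →ₗ[K] K where
  toFun f := (basisMonomials (Fin 3) K).constr K fun m => coeff m f / (m.multinomial : K)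
  map_add' f g := by
    rw [← map_add]
    congr 1
    ext m
    simp [add_div]
  map_smul' k f := by
    rw [RingHom.id_apply, ← map_smul]
    congr 1
    ext m
    simp [mul_div_assoc]

lemma dual_monomial (f : MvPolynomial (Fin 3) K) (m : Fin 3 →₀ ℕ) :
    dual f (monomial m 1) = coeff m f / (m.multinomial : K) := by
  have := (basisMonomials (Fin 3) K).constr_basis K (fun m => coeff m f / (m.multinomial : K)) m
  rwa [coe_basisMonomials] at this

lemma multinomial_ne_zero [CharZero K] (m : Fin 3 →₀ ℕ) : (m.multinomial : K) ≠ 0 :=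
  Nat.cast_ne_zero.2 (Nat.multinomial_pos _ _).ne'

lemma dual_lin_pow [CharZero K] (p : Fin 3 → K) {F : MvPolynomial (Fin 3) K}
    (hF : F.IsHomogeneous 4) : dual (lin p ^ 4) F = eval p F := by
  rw [← evalAt_apply]
  refine eq_on_quartics (fun a b c habc => ?_) hF
  rw [evalAt_apply, eval_monomial_three, monomial_expo, dual_monomial,
    div_eq_iff (multinomial_ne_zero _), lin]
  simp_rw [C_mul']
  rw [coeff_linearCombination_X_pow_of_fintype, degree_expo, if_pos habc, prod_expo]
  ring

lemma eq_of_dual_eq [CharZero K] {f g : MvPolynomial (Fin 3) K} (hf : f.IsHomogeneous 4)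
    (hg : g.IsHomogeneous 4)
    (h : ∀ F : MvPolynomial (Fin 3) K, F.IsHomogeneous 4 → dual f F = dual g F) : f = g := by
  ext m
  by_cases hm : m.degree = 4
  · have := h _ (isHomogeneous_monomial (1 : K) hm)
    rwa [dual_monomial, dual_monomial, div_left_inj' (multinomial_ne_zero m)] at this
  · rw [hf.coeff_eq_zero hm, hg.coeff_eq_zero hm]

lemma isSumOfPowers_zero (n : ℕ) : IsSumOfPowers 4 n (0 : MvPolynomial (Fin 3) K) :=
  ⟨0, fun _ => isHomogeneous_zero _ _ _, by simp⟩

lemma isSumOfPowers_cons {n : ℕ} {f L : MvPolynomial (Fin 3) K} (hf : IsSumOfPowers 4 n f)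
    (hL : L.IsHomogeneous 1) : IsSumOfPowers 4 (n + 1) (L ^ 4 + f) := by
  obtain ⟨M, hM, rfl⟩ := hf
  refine ⟨Fin.cons L M, fun i => ?_, ?_⟩
  · refine Fin.cases hL hM i
  · simp [Fin.sum_univ_succ]

lemma isSumOfPowers_mono {m n : ℕ} {f : MvPolynomial (Fin 3) K} (hf : IsSumOfPowers 4 m f)
    (hmn : m ≤ n) : IsSumOfPowers 4 n f := by
  induction n, hmn using Nat.le_induction with
  | base => exact hf
  | succ n _ ih => simpa using isSumOfPowers_cons ih (isHomogeneous_zero _ _ 1)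

lemma isSumOfPowers_list [IsAlgClosed K] (l : List (K × (Fin 3 → K))) :
    IsSumOfPowers 4 l.length (l.map fun q => C q.1 * lin q.2 ^ 4).sum := by
  induction l with
  | nil => exact isSumOfPowers_zero 0
  | cons q l ih =>
    obtain ⟨k, hk⟩ := IsAlgClosed.exists_pow_nat_eq q.1 (n := 4) (by norm_num)
    have := isSumOfPowers_cons ih (lin_isHomogeneous (k • q.2))
    rw [lin_smul, mul_pow, ← C_pow, hk] at this
    simpa using this

/-- Decompositions of the functional `dual f` into evaluations are decompositions of `f` into fourth
powers; the scalars are absorbed since they have fourth roots. -/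
lemma isSumOfPowers_of_hasDecomp [IsAlgClosed K] [CharZero K] {f : MvPolynomial (Fin 3) K}
    (hf : f.IsHomogeneous 4) {n : ℕ} (h : HasDecomp (dual f) n) : IsSumOfPowers 4 n f := by
  obtain ⟨l, hl, h⟩ := h
  have hhom (l : List (K × (Fin 3 → K))) :
      IsHomogeneous (l.map fun q : K × (Fin 3 → K) => C q.1 * lin q.2 ^ 4).sum 4 := by
    induction l with
    | nil => exact isHomogeneous_zero _ _ _
    | cons q l ih =>
      simp only [List.map_cons, List.sum_cons]
      exact (((lin_isHomogeneous q.2).pow 4).C_mul q.1).add ih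
  have hdual (l : List (K × (Fin 3 → K))) {F : MvPolynomial (Fin 3) K} (hF : F.IsHomogeneous 4) :
      dual (l.map fun q : K × (Fin 3 → K) => C q.1 * lin q.2 ^ 4).sum F
        = (l.map fun q => q.1 * eval q.2 F).sum := by
    induction l with
    | nil => simp
    | cons q l ih => simp [← ih, C_mul', dual_lin_pow q.2 hF]
  rw [eq_of_dual_eq hf (hhom l) fun F hF => by rw [h F hF, hdual l hF]]
  exact isSumOfPowers_mono (isSumOfPowers_list l) hl

lemma waringRank_le {f : MvPolynomial (Fin 3) K} {n : ℕ} (h : IsSumOfPowers 4 n f) :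
    waringRank 4 f ≤ n :=
  sInf_le ⟨n, rfl, h⟩

lemma le_waringRank {f : MvPolynomial (Fin 3) K} {n : ℕ} (h : ¬ IsSumOfPowers 4 n f) :
    ((n + 1 : ℕ) : ℕ∞) ≤ waringRank 4 f := by
  refine le_sInf ?_
  rintro _ ⟨m, rfl, hm⟩
  by_contra hlt
  rw [Nat.cast_le] at hlt
  exact h (isSumOfPowers_mono hm (by omega))

/-! ### The lower bound -/

/-- A line through two points that avoids `(1, 0, 0)`; points on the line `X₂ = 0` need not be
covered. The only obstruction is that the two points are collinear with `(1, 0, 0)`. -/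
lemma exists_line_through (P Q : Fin 3 → K)
    (h : ¬(P 2 ≠ 0 ∧ Q 2 ≠ 0 ∧ P 1 / P 2 = Q 1 / Q 2)) :
    ∃ u w : K, (P 2 = 0 ∨ eval P (lin ![1, u, w]) = 0) ∧
      (Q 2 = 0 ∨ eval Q (lin ![1, u, w]) = 0) := by
  simp only [eval_lin, Matrix.cons_val_zero, Matrix.cons_val_one, Matrix.cons_val]
  by_cases hP : P 2 = 0
  · by_cases hQ : Q 2 = 0
    · exact ⟨0, 0, Or.inl hP, Or.inl hQ⟩
    · exact ⟨0, -(Q 0 / Q 2), Or.inl hP, Or.inr (by field_simp; ring)⟩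
  · by_cases hQ : Q 2 = 0
    · exact ⟨0, -(P 0 / P 2), Or.inr (by field_simp; ring), Or.inl hQ⟩
    · have hd : P 1 * Q 2 - P 2 * Q 1 ≠ 0 := by
        intro hd
        refine h ⟨hP, hQ, ?_⟩
        rw [div_eq_div_iff hP hQ]
        linear_combination hd
      obtain ⟨d, hdef⟩ : ∃ d, d = P 1 * Q 2 - P 2 * Q 1 := ⟨_, rfl⟩
      rw [← hdef] at hd
      refine ⟨(Q 0 * P 2 - P 0 * Q 2) / d, (Q 1 * P 0 - P 1 * Q 0) / d, Or.inr ?_, Or.inr ?_⟩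
      · field_simp
        rw [hdef]
        ring
      · field_simp
        rw [hdef]
        ring

/-- Six points either split into three pairs, none of which lies on a line through `(1, 0, 0)`
other than `X₂ = 0`, or four of them lie on such a line: sort the points by their slopes and pair
each of the first three with its third successor. -/
lemma exists_pairing (p : Fin 6 → Fin 3 → K) :
    ∃ σ : Equiv.Perm (Fin 6),
      (∀ j : Fin 3, ¬(p (σ (Fin.castLE (by norm_num) j)) 2 ≠ 0 ∧
        p (σ (Fin.natAdd 3 j)) 2 ≠ 0 ∧
        p (σ (Fin.castLE (by norm_num) j)) 1 / p (σ (Fin.castLE (by norm_num) j)) 2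
          = p (σ (Fin.natAdd 3 j)) 1 / p (σ (Fin.natAdd 3 j)) 2)) ∨
      ∃ (s : K) (j : Fin 3), ∀ i : Fin 6, (j : ℕ) ≤ i → (i : ℕ) ≤ j + 3 →
        p (σ i) 1 = s * p (σ i) 2 := by
  classical
  let g : Fin 6 → Option K := fun i => if p i 2 = 0 then none else some (p i 1 / p i 2)
  obtain ⟨n, ⟨e⟩⟩ := Finite.exists_equiv_fin (Set.range g)
  let k : Fin 6 → Fin n := fun i => e ⟨g i, i, rfl⟩
  have hk {i j : Fin 6} (h : k i = k j) : g i = g j := congrArg Subtype.val (e.injective h)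
  have hmono := Tuple.monotone_sort k
  refine ⟨Tuple.sort k, ?_⟩
  by_contra! hcon
  obtain ⟨⟨j, h1, h2, h3⟩, hline⟩ := hcon
  set σ := Tuple.sort k
  obtain ⟨i, hi1, hi2, hne⟩ := hline (p (σ (Fin.castLE (by norm_num) j)) 1
    / p (σ (Fin.castLE (by norm_num) j)) 2) j
  have hg : g (σ (Fin.castLE (by norm_num) j)) = g (σ (Fin.natAdd 3 j)) := by
    simp only [g, if_neg h1, if_neg h2, h3]
  have hkeq : k (σ (Fin.castLE (by norm_num) j)) = k (σ (Fin.natAdd 3 j)) := by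
    simp only [k]
    congr 2
  have hle1 : k (σ (Fin.castLE (by norm_num) j)) ≤ k (σ i) := hmono (by
    rw [Fin.le_def]; simpa using hi1)
  have hle2 : k (σ i) ≤ k (σ (Fin.natAdd 3 j)) := hmono (by
    rw [Fin.le_def]; simp; omega)
  have hgi := hk (le_antisymm hle1 (hle2.trans hkeq.ge))
  simp only [g, if_neg h1] at hgi
  split_ifs at hgi with h0
  apply hne
  rw [Option.some.inj hgi, div_mul_cancel₀ _ h0]

/-- The expansion of `F` along the curve germ `T ↦ (1, T, l T²)`. -/
noncomputable def germ (l : K) : MvPolynomial (Fin 3) K →ₐ[K] Polynomial K :=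
  aeval ![1, Polynomial.X, Polynomial.C l * Polynomial.X ^ 2]

lemma germ_lin_coeff_zero (l u w : K) : (germ l (lin ![1, u, w])).coeff 0 = 1 := by
  simp [germ, lin_eq]

lemma germ_lin_coeff_one (l u w : K) : (germ l (lin ![1, u, w])).coeff 1 = u := by
  simp [germ, lin_eq, Polynomial.coeff_one, Polynomial.coeff_X_pow]

lemma cubic_isHomogeneous (u v w : Fin 3 → K) : (lin u * lin v * lin w).IsHomogeneous 3 :=
  ((lin_isHomogeneous u).mul (lin_isHomogeneous v)).mul (lin_isHomogeneous w)

/-- The second Taylor coefficient along a germ of contact order two with its tangent line `X₂ = 0`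
is not a sum of six evaluations on quartic forms. If the points off the tangent line lie on three
lines avoiding `(1, 0, 0)`, then these and the tangent line give a quartic contradicting this.
Otherwise four of the points lie on a line through `(1, 0, 0)`, and that line, lines through the two
remaining points, and a suitable fourth line do so. -/
lemma not_sum_six_evals [CharZero K] (p : Fin 6 → Fin 3 → K) {k l : K} (hk : k ≠ 0) (hl : l ≠ 0) :
    ¬ ∀ F : MvPolynomial (Fin 3) K, F.IsHomogeneous 4 →
      ∑ i, eval (p i) F = k * (germ l F).coeff 2 := by
  intro h
  obtain ⟨σ, hσ | ⟨s, j, hs⟩⟩ := exists_pairing p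
  · choose u w h1 h2 using fun j => exists_line_through _ _ (hσ j)
    have hcov (i : Fin 6) : ∃ j : Fin 3, p (σ i) 2 = 0 ∨
        eval (p (σ i)) (lin ![1, u j, w j]) = 0 := by
      refine Fin.addCases (m := 3) (n := 3) (fun j => ⟨j, h1 j⟩) (fun j => ⟨j, h2 j⟩) i
    have := h (lin ![0, 0, 1] * (lin ![1, u 0, w 0] * lin ![1, u 1, w 1] * lin ![1, u 2, w 2]))
      ((lin_isHomogeneous _).mul (cubic_isHomogeneous _ _ _))
    rw [Finset.sum_eq_zero fun i _ => ?_] at this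
    · have h3 : germ l (lin ![0, 0, 1]) = Polynomial.X ^ 2 * Polynomial.C l := by
        simp [germ, lin_eq]
      have hc (A : Polynomial K) : (Polynomial.X ^ 2 * A).coeff 2 = A.coeff 0 := by
        simpa using Polynomial.coeff_X_pow_mul A 2 0
      rw [map_mul, h3, mul_assoc, hc,
        Polynomial.coeff_C_mul, map_mul, map_mul, Polynomial.mul_coeff_zero,
        Polynomial.mul_coeff_zero, germ_lin_coeff_zero, germ_lin_coeff_zero,
        germ_lin_coeff_zero] at this
      simp [hk, hl] at this
    · obtain ⟨j, hj⟩ := hcov (σ.symm i)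
      rw [σ.apply_symm_apply] at hj
      simp only [eval_mul]
      rcases hj with hj | hj
      · have : eval (p i) (lin ![0, 0, 1]) = 0 := by simp [eval_lin, hj]
        rw [this, zero_mul]
      · fin_cases j <;> simp only [Fin.zero_eta, Fin.mk_one, Fin.reduceFinMk] at hj <;>
          rw [hj] <;> ring
  · have hline (P : Fin 3 → K) : ∃ u w : K,
        eval P (lin ![0, 1, -s]) * eval P (lin ![1, u, w]) = 0 := by
      simp only [eval_lin, Matrix.cons_val_zero, Matrix.cons_val_one, Matrix.cons_val]
      by_cases h2 : P 2 = 0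
      · by_cases h1 : P 1 = 0
        · exact ⟨0, 0, by simp [h1, h2]⟩
        · exact ⟨-(P 0 / P 1), 0, by field_simp; ring⟩
      · exact ⟨0, -(P 0 / P 2), by field_simp; ring⟩
    have hpt (i : Fin 6) (hi1 : (j : ℕ) ≤ i) (hi2 : (i : ℕ) ≤ j + 3) :
        eval (p (σ i)) (lin ![0, 1, -s]) = 0 := by
      simp [eval_lin, hs i hi1 hi2]
    -- The two points that need not lie on the line.
    obtain ⟨i₁, i₂, hi⟩ : ∃ i₁ i₂ : Fin 6, ∀ i : Fin 6, i = i₁ ∨ i = i₂ ∨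
        ((j : ℕ) ≤ i ∧ (i : ℕ) ≤ j + 3) := by
      fin_cases j
      · exact ⟨4, 5, by decide⟩
      · exact ⟨0, 5, by decide⟩
      · exact ⟨0, 1, by decide⟩
    obtain ⟨u₁, w₁, e₁⟩ := hline (p (σ i₁))
    obtain ⟨u₂, w₂, e₂⟩ := hline (p (σ i₂))
    -- The last line is chosen such that the right-hand side equals `k`.
    set u₃ := 1 - u₁ - u₂ + s * l with hu₃
    have := h (lin ![0, 1, -s] * (lin ![1, u₁, w₁] * lin ![1, u₂, w₂] * lin ![1, u₃, 0]))
      ((lin_isHomogeneous _).mul (cubic_isHomogeneous _ _ _))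
    rw [Finset.sum_eq_zero fun i _ => ?_] at this
    · have h3 : germ l (lin ![0, 1, -s])
          = Polynomial.X ^ 1 * (1 - Polynomial.C (s * l) * Polynomial.X) := by
        simp [germ, lin_eq]
        ring
      have hc (A : Polynomial K) : (Polynomial.X ^ 1 * A).coeff 2 = A.coeff 1 := by
        simp
      rw [map_mul, h3, mul_assoc, hc] at this
      simp only [map_mul, Polynomial.mul_coeff_one, Polynomial.mul_coeff_zero,
        germ_lin_coeff_zero, germ_lin_coeff_one] at this
      simp [Polynomial.coeff_one] at this
      refine this.elim hk fun h0 => ?_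
      rw [hu₃] at h0
      exact one_ne_zero (α := K) (by linear_combination h0)
    · simp only [eval_mul]
      rcases hi (σ.symm i) with h' | h' | ⟨h', h''⟩
      · rw [← h', σ.apply_symm_apply] at e₁
        linear_combination (eval (p i) (lin ![1, u₂, w₂]) * eval (p i) (lin ![1, u₃, 0])) * e₁
      · rw [← h', σ.apply_symm_apply] at e₂
        linear_combination (eval (p i) (lin ![1, u₁, w₁]) * eval (p i) (lin ![1, u₃, 0])) * e₂
      · have := hpt _ h' h''
        rw [σ.apply_symm_apply] at this
        rw [this, zero_mul]

/-- The functional of `α X₀³X₂ + β X₀²X₁²` is a multiple of the second Taylor coefficient along a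
curve germ. -/
lemma dual_normalForm [CharZero K] {α β : K} (hβ : β ≠ 0) {F : MvPolynomial (Fin 3) K}
    (hF : F.IsHomogeneous 4) :
    dual (C α * (X 0 ^ 3 * X 1 ^ 0 * X 2 ^ 1) + C β * (X 0 ^ 2 * X 1 ^ 2 * X 2 ^ 0)) F
      = β / 6 * (germ (3 * α / (2 * β)) F).coeff 2 := by
  refine eq_on_quartics (φ := dual _) (χ := (β / 6) • Polynomial.lcoeff K 2 ∘ₗ
    (germ (3 * α / (2 * β))).toLinearMap) (fun a b c habc => ?_) hF
  have hg : germ (3 * α / (2 * β)) (X 0 ^ a * X 1 ^ b * X 2 ^ c)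
      = Polynomial.C ((3 * α / (2 * β)) ^ c) * Polynomial.X ^ (b + 2 * c) := by
    simp [germ]
    ring
  simp only [LinearMap.smul_apply, LinearMap.comp_apply, AlgHom.toLinearMap_apply,
    Polynomial.lcoeff_apply, hg, Polynomial.coeff_C_mul, Polynomial.coeff_X_pow, smul_eq_mul]
  rw [monomial_expo, monomial_expo, monomial_expo, dual_monomial, multinomial_expo]
  simp only [coeff_add, coeff_C_mul, coeff_monomial, expo_injective]
  have ha : a ≤ 4 := by omega
  have hb : b ≤ 4 := by omega
  obtain rfl : c = 4 - a - b := by omega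
  interval_cases a <;> interval_cases b <;> first | omega | skip
  all_goals simp [Nat.factorial]
  all_goals field_simp
  all_goals ring

/-- The symmetric matrix of twice the quadratic form with the given coefficients. -/
def gram (c : Fin 6 → K) : Matrix (Fin 3) (Fin 3) K :=
  !![2 * c 0, c 1, c 2; c 1, 2 * c 3, c 4; c 2, c 4, 2 * c 5]

lemma gram_mulVec (c : Fin 6 → K) (p : Fin 3 → K) :
    (gram c).mulVec p = ![2 * c 0 * p 0 + c 1 * p 1 + c 2 * p 2,
      c 1 * p 0 + 2 * c 3 * p 1 + c 4 * p 2, c 2 * p 0 + c 4 * p 1 + 2 * c 5 * p 2] := by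
  ext i
  fin_cases i <;> simp [gram, Matrix.mulVec, dotProduct, Fin.sum_univ_three]

lemma eval_pderiv_conic (c : Fin 6 → K) (p : Fin 3 → K) (i : Fin 3) :
    eval p (pderiv i (conic c)) = (gram c).mulVec p i := by
  fin_cases i <;>
    simp [conic, gram, Matrix.mulVec, dotProduct, Fin.sum_univ_three, pderiv_X] <;>
    ring

/-- In suitable coordinates, a nonsingular conic with a tangent line is
`α X₀X₂ + β X₁²` with the line `X₀ = 0`. -/
lemma exists_subst_normalForm [CharZero K] {q l : MvPolynomial (Fin 3) K}
    (hq : IsNondegenerateConic q) (hl : IsTangentLine q l) :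
    ∃ (M : Matrix (Fin 3) (Fin 3) K) (α β γ : K), α ≠ 0 ∧ β ≠ 0 ∧ γ ≠ 0 ∧
      subst M q = C α * (X 0 * X 2) + C β * (X 1 * X 1) ∧ subst M l = C γ * X 0 := by
  obtain ⟨hq2, hq⟩ := hq
  obtain ⟨p, hp0, hpq, k, hk, rfl⟩ := hl
  obtain ⟨c, rfl⟩ := exists_conic hq2
  simp only [eval_pderiv_conic] at hq ⊢
  rw [eval_conic] at hpq
  have hdet : (gram c).det ≠ 0 := by
    intro h0
    obtain ⟨v, hv, hv0⟩ := Matrix.exists_mulVec_eq_zero_iff.2 h0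
    exact hv (hq v fun i => by rw [hv0]; rfl)
  obtain ⟨i, hi⟩ : ∃ i, (gram c).mulVec p i ≠ 0 := by
    by_contra! hcon
    exact hp0 (hq p hcon)
  -- A second point `v` of the conic, off the tangent line.
  obtain ⟨v, hvq, hvp⟩ : ∃ v : Fin 3 → K, c 0 * (v 0 * v 0) + c 1 * (v 0 * v 1)
      + c 2 * (v 0 * v 2) + c 3 * (v 1 * v 1) + c 4 * (v 1 * v 2) + c 5 * (v 2 * v 2) = 0 ∧
      (gram c).mulVec p 0 * v 0 + (gram c).mulVec p 1 * v 1 + (gram c).mulVec p 2 * v 2 ≠ 0 := by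
    obtain ⟨e, he⟩ : ∃ e : Fin 3 → K, (gram c).mulVec p 0 * e 0 + (gram c).mulVec p 1 * e 1
        + (gram c).mulVec p 2 * e 2 ≠ 0 :=
      ⟨Pi.single i 1, by fin_cases i <;> simpa using hi⟩
    obtain ⟨B, hB⟩ : ∃ B, B = (gram c).mulVec p 0 * e 0 + (gram c).mulVec p 1 * e 1
        + (gram c).mulVec p 2 * e 2 := ⟨_, rfl⟩
    rw [← hB] at he
    simp only [gram_mulVec, Matrix.cons_val_zero, Matrix.cons_val_one, Matrix.cons_val] at hB ⊢
    -- The line through `p` and `e` meets the conic in a second point.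
    obtain ⟨r, hr⟩ : ∃ r, r * B = c 0 * (e 0 * e 0) + c 1 * (e 0 * e 1) + c 2 * (e 0 * e 2)
        + c 3 * (e 1 * e 1) + c 4 * (e 1 * e 2) + c 5 * (e 2 * e 2) :=
      ⟨_, div_mul_cancel₀ _ he⟩
    refine ⟨e - r • p, ?_, ?_⟩
    · simp only [Pi.sub_apply, Pi.smul_apply, smul_eq_mul]
      linear_combination r ^ 2 * hpq - hr + r * hB
    · convert he using 1
      simp only [Pi.sub_apply, Pi.smul_apply, smul_eq_mul]
      linear_combination -hB - 2 * r * hpq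
  -- The pole of the line joining the two points.
  obtain ⟨w, hw⟩ : ∃ w, w = crossProduct ((gram c).mulVec p) ((gram c).mulVec v) := ⟨_, rfl⟩
  have hw0 : w 0 = (gram c).mulVec p 1 * (gram c).mulVec v 2
      - (gram c).mulVec p 2 * (gram c).mulVec v 1 := by rw [hw, cross_apply]; rfl
  have hw1 : w 1 = (gram c).mulVec p 2 * (gram c).mulVec v 0
      - (gram c).mulVec p 0 * (gram c).mulVec v 2 := by rw [hw, cross_apply]; rfl
  have hw2 : w 2 = (gram c).mulVec p 0 * (gram c).mulVec v 1
      - (gram c).mulVec p 1 * (gram c).mulVec v 0 := by rw [hw, cross_apply]; rfl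
  obtain ⟨g, hg⟩ : ∃ g, g = (gram c).mulVec p := ⟨_, rfl⟩
  obtain ⟨g', hg'⟩ : ∃ g', g' = (gram c).mulVec v := ⟨_, rfl⟩
  rw [← hg] at hvp hw0 hw1 hw2 ⊢
  rw [← hg'] at hw0 hw1 hw2
  have hgw : g 0 * w 0 + g 1 * w 1 + g 2 * w 2 = 0 := by rw [hw0, hw1, hw2]; ring
  have hgw' : g' 0 * w 0 + g' 1 * w 1 + g' 2 * w 2 = 0 := by rw [hw0, hw1, hw2]; ring
  have hgp : g 0 * p 0 + g 1 * p 1 + g 2 * p 2 = 0 := by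
    rw [hg]
    simp only [gram_mulVec, Matrix.cons_val_zero, Matrix.cons_val_one, Matrix.cons_val]
    linear_combination 2 * hpq
  have hwq : 2 * (c 0 * (w 0 * w 0) + c 1 * (w 0 * w 1) + c 2 * (w 0 * w 2) + c 3 * (w 1 * w 1)
      + c 4 * (w 1 * w 2) + c 5 * (w 2 * w 2))
      = -(gram c).det * (g 0 * v 0 + g 1 * v 1 + g 2 * v 2) ^ 2 := by
    -- With `S = gram c`, the vector `Sp × Sv` is the adjugate of `S` applied to `p × v`, so this is
    -- the Binet-Cauchy identity for `(p × v) ⬝ (Sp × Sv)`.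
    have : 2 * (c 0 * (w 0 * w 0) + c 1 * (w 0 * w 1) + c 2 * (w 0 * w 2) + c 3 * (w 1 * w 1)
        + c 4 * (w 1 * w 2) + c 5 * (w 2 * w 2))
        = (gram c).det * ((g 0 * p 0 + g 1 * p 1 + g 2 * p 2)
            * (g' 0 * v 0 + g' 1 * v 1 + g' 2 * v 2)
          - (g 0 * v 0 + g 1 * v 1 + g 2 * v 2) ^ 2) := by
      rw [hw0, hw1, hw2, hg, hg', Matrix.det_fin_three]
      simp only [gram_mulVec, Matrix.cons_val_zero, Matrix.cons_val_one, Matrix.cons_val]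
      simp only [gram, Matrix.of_apply, Matrix.cons_val]
      ring
    rw [this, hgp]
    ring
  have hMX (i : Fin 3) : subst (Matrix.of fun i => ![v i, w i, p i]) (X i)
      = C (v i) * X 0 + C (w i) * X 1 + C (p i) * X 2 := by
    rw [subst_X, lin_eq]; rfl
  refine ⟨Matrix.of fun i => ![v i, w i, p i], g 0 * v 0 + g 1 * v 1 + g 2 * v 2,
    c 0 * (w 0 * w 0) + c 1 * (w 0 * w 1) + c 2 * (w 0 * w 2) + c 3 * (w 1 * w 1)
      + c 4 * (w 1 * w 2) + c 5 * (w 2 * w 2), k * (g 0 * v 0 + g 1 * v 1 + g 2 * v 2), hvp, ?_,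
    mul_ne_zero hk hvp, ?_, ?_⟩
  · intro h0
    rw [h0, mul_zero] at hwq
    exact mul_ne_zero (neg_ne_zero.2 hdet) (pow_ne_zero 2 hvp) hwq.symm
  · have e1 := congrArg (C : K → MvPolynomial (Fin 3) K) hvq
    have e2 := congrArg (C : K → MvPolynomial (Fin 3) K) hpq
    have hC2 : (C 2 : MvPolynomial (Fin 3) K) = 2 := map_ofNat C 2
    rw [hg] at hgw
    rw [hg'] at hgw'
    have e3 := congrArg (C : K → MvPolynomial (Fin 3) K) hgw
    have e4 := congrArg (C : K → MvPolynomial (Fin 3) K) hgw'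
    rw [hg]
    simp only [gram_mulVec, Matrix.cons_val_zero, Matrix.cons_val_one, Matrix.cons_val] at e3 e4 ⊢
    simp only [C_add, C_mul, C_0, hC2] at e1 e2 e3 e4 ⊢
    simp only [conic, map_add, map_mul, hMX, algHom_C, algebraMap_eq]
    linear_combination X 0 * X 0 * e1 + X 2 * X 2 * e2 + X 1 * X 2 * e3 + X 0 * X 1 * e4
  · have e1 := congrArg (C : K → MvPolynomial (Fin 3) K) hgw
    have e2 := congrArg (C : K → MvPolynomial (Fin 3) K) hgp
    simp only [C_add, C_mul, C_0] at e1 e2 ⊢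
    simp only [Fin.sum_univ_three, map_add, map_mul, hMX, algHom_C, algebraMap_eq]
    linear_combination C k * X 1 * e1 + C k * X 2 * e2

theorem not_isSumOfPowers_conic_mul_tangent_sq [CharZero K] {q l : MvPolynomial (Fin 3) K}
    (hq : IsNondegenerateConic q) (hl : IsTangentLine q l) :
    ¬ IsSumOfPowers 4 6 (q * l ^ 2) := by
  rintro ⟨L, hL, hf⟩
  obtain ⟨M, α, β, γ, hα, hβ, hγ, hMq, hMl⟩ := exists_subst_normalForm hq hl
  choose p hp using fun i => exists_lin (subst_isHomogeneous M (hL i))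
  have hf' := congrArg (subst M) hf
  rw [map_mul, map_pow, hMq, hMl, map_sum] at hf'
  simp_rw [map_pow, hp] at hf'
  refine not_sum_six_evals p (k := γ ^ 2 * β / 6) (l := 3 * (γ ^ 2 * α) / (2 * (γ ^ 2 * β)))
    (div_ne_zero (mul_ne_zero (pow_ne_zero 2 hγ) hβ) (by norm_num))
    (div_ne_zero (mul_ne_zero (by norm_num) (mul_ne_zero (pow_ne_zero 2 hγ) hα))
      (mul_ne_zero (by norm_num) (mul_ne_zero (pow_ne_zero 2 hγ) hβ))) fun F hF => ?_
  rw [← dual_normalForm (mul_ne_zero (pow_ne_zero 2 hγ) hβ) hF]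
  have e : C (γ ^ 2 * α) * (X 0 ^ 3 * X 1 ^ 0 * X 2 ^ 1)
      + C (γ ^ 2 * β) * (X 0 ^ 2 * X 1 ^ 2 * X 2 ^ 0) = ∑ i, lin (p i) ^ 4 := by
    rw [← hf', C_mul, C_mul, C_pow]
    ring
  rw [e, map_sum, LinearMap.sum_apply]
  exact Finset.sum_congr rfl fun i _ => (dual_lin_pow (p i) hF).symm

end PlaneQuartic

theorem mainTheorem1 {K : Type*} [Field K] [IsAlgClosed K] [CharZero K] :
    (∀ f : MvPolynomial (Fin 3) K, f.IsHomogeneous 4 → waringRank 4 f ≤ 7) ∧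
    (∀ q l : MvPolynomial (Fin 3) K, IsNondegenerateConic q → IsTangentLine q l →
      waringRank 4 (q * l ^ 2) = 7) ∧
    IsGreatest {r : ℕ∞ | ∃ f : MvPolynomial (Fin 3) K, f.IsHomogeneous 4 ∧ waringRank 4 f = r}
      7 := by
  have hle (f : MvPolynomial (Fin 3) K) (hf : f.IsHomogeneous 4) : waringRank 4 f ≤ 7 :=
    PlaneQuartic.waringRank_le
      (PlaneQuartic.isSumOfPowers_of_hasDecomp hf (PlaneQuartic.hasDecomp_seven _))
  have hhom (q l : MvPolynomial (Fin 3) K) (hq : IsNondegenerateConic q)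
      (hl : IsTangentLine q l) : (q * l ^ 2).IsHomogeneous 4 := by
    obtain ⟨p, -, -, c, -, rfl⟩ := hl
    refine hq.1.mul (MvPolynomial.IsHomogeneous.pow (m := 1) ?_ 2)
    exact (PlaneQuartic.lin_isHomogeneous _).C_mul c
  have heq (q l : MvPolynomial (Fin 3) K) (hq : IsNondegenerateConic q)
      (hl : IsTangentLine q l) : waringRank 4 (q * l ^ 2) = 7 :=
    le_antisymm (hle _ (hhom q l hq hl))
      (PlaneQuartic.le_waringRank (PlaneQuartic.not_isSumOfPowers_conic_mul_tangent_sq hq hl))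
  refine ⟨hle, heq, ?_, ?_⟩
  · -- The conic `X₀X₂ = X₁²` with its tangent line at `(1, 0, 0)`.
    have hq : IsNondegenerateConic
        (PlaneQuartic.conic ![0, 0, 1, -1, 0, 0] : MvPolynomial (Fin 3) K) := by
      refine ⟨PlaneQuartic.conic_isHomogeneous _, fun p hp => ?_⟩
      have h0 := hp 0
      have h1 := hp 1
      have h2 := hp 2
      rw [PlaneQuartic.eval_pderiv_conic] at h0 h1 h2
      simp [PlaneQuartic.gram, Matrix.mulVec, dotProduct, Fin.sum_univ_three] at h0 h1 h2
      ext i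
      fin_cases i <;> simp [h0, h1, h2]
    have hl : IsTangentLine (PlaneQuartic.conic ![0, 0, 1, -1, 0, 0] : MvPolynomial (Fin 3) K) _ :=
      ⟨![1, 0, 0], fun h => one_ne_zero (congrFun h 0), by simp [PlaneQuartic.eval_conic], 1,
        one_ne_zero, rfl⟩
    exact ⟨_, hhom _ _ hq hl, heq _ _ hq hl⟩
  · rintro _ ⟨f, hf, rfl⟩
    exact hle f hf
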